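/- Let $n\ge 1$, write $\langle z,\zeta\rangle=\sum_i z_i\zeta_i$ for the bilinear pairing on $\mathbb C^n$, and let $A,B,C$ be complex $n\times n$ matrices with ${}^tA=A$, $\det B\ne 0$, ${}^tC=C$ and $C_I:=(C-\bar C)/(2\sqrt{-1})$ positive definite. Put $\phi(z,x)=\tfrac12\langle z,Az\rangle+\langle z,Bx\rangle+\tfrac12\langle x,Cx\rangle$, $$\Phi(z)=\max_{x\in\mathbb R^n}\operatorname{Re}\{\sqrt{-1}\,\phi(z,x)\},\qquad \Phi''_{z\bar z}=\tfrac14 BC_I^{-1}B^*,\qquad \Phi''_{zz}=-\tfrac14BC_I^{-1}\,{}^tB-\tfrac1{2\sqrt{-1}}A ,$$ and let $\mathscr H_\Phi(\mathbb C^n)$ be the Hilbert space of entire functions on $\mathbb C^n$ that are square-integrable with respect to $e^{-2\Phi(z)}L(dz)$, where $L$ is Lebesgue measure on $\mathbb C^n\simeq\mathbb R^{2n}$, with inner product $(F,G)=\int F\bar G\,e^{-2\Phi}\,dL$. Let $U$ be a unitary matrix and $\lambda_1,\dots,\lambda_n>0$ with $U^*\Phi''_{z\bar z}U=\operatorname{diag}(\lambda_1^2,\dots,\lambda_n^2)$,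 put $\lambda_0=\min_i\lambda_i$, let $0<\rho<\lambda_0$ and $\mu_i=\sqrt{\lambda_i^2-\rho^2}$. Let $X$ be a unitary matrix with ${}^tX\operatorname{diag}(\mu_i/\lambda_i)=\operatorname{diag}(\mu_i/\lambda_i)X$ and set $$Q=-\Phi''_{zz}+U\operatorname{diag}(\mu_1,\dots,\mu_n)\,X\operatorname{diag}(\lambda_1,\dots,\lambda_n)\,{}^tU .$$ Let $\tilde\psi_0(z)=e^{-\langle z,Qz\rangle}$, which belongs to $\mathscr H_\Phi(\mathbb C^n)$, let $\Lambda_i=\partial/\partial z_i+2(Qz)_i$, let $\Lambda_i^*$ be its adjoint in $\mathscr H_\Phi(\mathbb C^n)$ (with $\Lambda_i$ on its maximal domain), and for $\alpha\in\mathbb N_0^n$ set $$\tilde\psi_\alpha=(\Lambda_1^*)^{\alpha_1}\cdots(\Lambda_n^*)^{\alpha_n}\tilde\psi_0,\qquad \psi_\alpha=\frac{\tilde\psi_\alpha}{\sqrt{(2\rho^2)^{|\alpha|}\alpha!}\;\|\tilde\psi_0\|_{\mathscr H_\Phi(\mathbb C^n)}} .$$ Then $\{\psi_\alpha\}_{\alpha\in\mathbb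 N_0^n}$ is a complete orthonormal system (Hilbert basis) of $\mathscr H_\Phi(\mathbb C^n)$. -/

import Mathlib

open scoped Matrix

noncomputable section

/-- The matrices `A`, `B`, `C` of a Bargmann-type phase
`φ(z,x) = ⟨z,Az⟩/2 + ⟨z,Bx⟩ + ⟨x,Cx⟩/2`: `A` and `C` are symmetric, `B` is invertible and
`C_I = (C - C̄)/(2i)` is positive definite. -/
structure BargmannPhase (n : ℕ) where
  A : Matrix (Fin n) (Fin n) ℂ
  B : Matrix (Fin n) (Fin n) ℂ
  C : Matrix (Fin n) (Fin n) ℂ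
  symm_A : Aᵀ = A
  det_B : B.det ≠ 0
  symm_C : Cᵀ = C
  posDef_CI : open scoped ComplexOrder in
    ((1 / (2 * Complex.I)) • (C - C.map (starRingEnd ℂ))).PosDef

namespace BargmannPhase

variable {n : ℕ} (P : BargmannPhase n)

/-- `C_I = (C - C̄)/(2i)`. -/
def CI : Matrix (Fin n) (Fin n) ℂ :=
  (1 / (2 * Complex.I)) • (P.C - P.C.map (starRingEnd ℂ))

/-- The phase function `φ(z,x)`; `⬝ᵥ` is the bilinear pairing `⟨z,ζ⟩ = ∑ zᵢ ζᵢ`. -/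
def phase (z : Fin n → ℂ) (x : Fin n → ℝ) : ℂ :=
  1 / 2 * (z ⬝ᵥ P.A *ᵥ z) + z ⬝ᵥ P.B *ᵥ (fun i => (x i : ℂ))
    + 1 / 2 * ((fun i => (x i : ℂ)) ⬝ᵥ P.C *ᵥ (fun i => (x i : ℂ)))

/-- The weight `Φ(z) = max_{x ∈ ℝⁿ} Re (i φ(z,x))`. -/
def weight (z : Fin n → ℂ) : ℝ :=
  ⨆ x : Fin n → ℝ, (Complex.I * P.phase z x).re

/-- `Φ''_{z z̄} = B C_I⁻¹ B* / 4`. -/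
def hessMixed : Matrix (Fin n) (Fin n) ℂ :=
  (1 / 4 : ℂ) • (P.B * P.CI⁻¹ * P.Bᴴ)

/-- `Φ''_{zz} = - B C_I⁻¹ ᵗB / 4 - A / (2i)`. -/
def hessHol : Matrix (Fin n) (Fin n) ℂ :=
  -((1 / 4 : ℂ) • (P.B * P.CI⁻¹ * P.Bᵀ)) - (1 / (2 * Complex.I)) • P.A

/-! The supremum is attained, and equals
`⟨z, Φ''_{z z̄} z̄⟩ + Re ⟨z, Φ''_{zz} z⟩`; in particular the weight is continuous. -/

/-- The entrywise imaginary part of `C`, as a real matrix. -/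
def imC : Matrix (Fin n) (Fin n) ℝ := P.C.map Complex.im

theorem CI_eq : P.CI = P.imC.map Complex.ofReal := by
  ext i j
  simp only [CI, imC, Matrix.smul_apply, Matrix.sub_apply, Matrix.map_apply, smul_eq_mul]
  rw [Complex.sub_conj]
  field_simp
  push_cast
  ring

theorem imC_symm : P.imCᵀ = P.imC := by
  ext i j
  have := congrFun (congrFun P.symm_C i) j
  simp only [Matrix.transpose_apply] at this
  simp [imC, this]

open scoped ComplexOrder in
theorem imC_posDef : P.imC.PosDef := by
  have h := P.posDef_CI
  refine Matrix.PosDef.of_dotProduct_mulVec_pos ?_ ?_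
  · rw [Matrix.IsHermitian, Matrix.conjTranspose_eq_transpose_of_trivial]
    exact P.imC_symm
  · intro x hx
    have hx' : (fun i => (x i : ℂ)) ≠ 0 := by
      intro h0
      apply hx
      ext i
      simpa using congrFun h0 i
    have h2 := h.dotProduct_mulVec_pos hx'
    change 0 < star (fun i => (x i : ℂ)) ⬝ᵥ (P.CI *ᵥ fun i => (x i : ℂ)) at h2
    rw [P.CI_eq] at h2
    have h3 : star (fun i => (x i : ℂ)) ⬝ᵥ ((P.imC.map Complex.ofReal) *ᵥ fun i => (x i : ℂ))
        = ((star x ⬝ᵥ P.imC *ᵥ x : ℝ) : ℂ) := by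
      simp [dotProduct, Matrix.mulVec]
    rw [h3] at h2
    exact_mod_cast h2

theorem CI_inv : P.CI⁻¹ = (P.imC⁻¹).map Complex.ofReal := by
  have hu : IsUnit P.imC.det := P.imC_posDef.det_pos.ne'.isUnit
  apply Matrix.inv_eq_right_inv
  rw [P.CI_eq]
  change P.imC.map Complex.ofRealHom * P.imC⁻¹.map Complex.ofRealHom = 1
  rw [← Matrix.map_mul, Matrix.mul_nonsing_inv P.imC hu]
  simp

/-- The closed form of the weight. -/
def weightForm (z : Fin n → ℂ) : ℝ :=
  (z ⬝ᵥ P.hessMixed *ᵥ star z).re + (z ⬝ᵥ P.hessHol *ᵥ z).re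

theorem weightForm_eq (z : Fin n → ℂ) :
    P.weightForm z = (Complex.I * (1 / 2 * (z ⬝ᵥ P.A *ᵥ z))).re
      + 1 / 2 * ((fun i => ((z ᵥ* P.B) i).im) ⬝ᵥ P.imC⁻¹ *ᵥ fun i => ((z ᵥ* P.B) i).im) := by
  have h1 : z ⬝ᵥ P.hessMixed *ᵥ star z
      = 1 / 4 * ((z ᵥ* P.B) ⬝ᵥ P.CI⁻¹ *ᵥ star (z ᵥ* P.B)) := by
    simp only [hessMixed, Matrix.smul_mulVec, dotProduct_smul, smul_eq_mul]
    rw [Matrix.star_vecMul, ← Matrix.mulVec_mulVec, ← Matrix.mulVec_mulVec,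
      Matrix.dotProduct_mulVec]
  have h2 : z ⬝ᵥ P.hessHol *ᵥ z
      = -(1 / 4 * ((z ᵥ* P.B) ⬝ᵥ P.CI⁻¹ *ᵥ (z ᵥ* P.B)))
        + Complex.I * (1 / 2 * (z ⬝ᵥ P.A *ᵥ z)) := by
    simp only [hessHol, Matrix.sub_mulVec, Matrix.neg_mulVec, Matrix.smul_mulVec, dotProduct_smul,
      smul_eq_mul, dotProduct_sub, dotProduct_neg]
    rw [← Matrix.mulVec_mulVec, ← Matrix.mulVec_mulVec, Matrix.mulVec_transpose,
      Matrix.dotProduct_mulVec z P.B]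
    have : (1 / (2 * Complex.I)) = -(Complex.I * (1 / 2)) := by
      field_simp
      simp
    rw [this]
    ring
  rw [weightForm, h1, h2, P.CI_inv]
  generalize z ᵥ* P.B = w
  have h3 : ∀ v : Fin n → ℂ, (w ⬝ᵥ (P.imC⁻¹.map Complex.ofReal) *ᵥ v).re
      = ∑ i, ∑ j, P.imC⁻¹ i j * ((w i).re * (v j).re - (w i).im * (v j).im) := by
    intro v
    simp only [dotProduct, Matrix.mulVec, Finset.mul_sum, Complex.re_sum, Matrix.map_apply]
    refine Finset.sum_congr rfl fun i _ => Finset.sum_congr rfl fun j _ => ?_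
    simp
    ring
  have h4 : ∀ c : ℂ, (1 / 4 * c).re = 1 / 4 * c.re := by
    intro c
    have : (1 / 4 : ℂ) = ((1 / 4 : ℝ) : ℂ) := by norm_num
    rw [this, Complex.re_ofReal_mul]
  rw [Complex.add_re, Complex.neg_re, h4, h4, h3, h3]
  have h5 : (fun i => (w i).im) ⬝ᵥ P.imC⁻¹ *ᵥ (fun i => (w i).im)
      = ∑ i, ∑ j, P.imC⁻¹ i j * ((w i).im * (w j).im) := by
    simp only [dotProduct, Matrix.mulVec, Finset.mul_sum]
    refine Finset.sum_congr rfl fun i _ => Finset.sum_congr rfl fun j _ => ?_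
    ring
  rw [h5]
  have h6 : ∑ i, ∑ j, P.imC⁻¹ i j * ((w i).re * (star w j).re - (w i).im * (star w j).im)
      - ∑ i, ∑ j, P.imC⁻¹ i j * ((w i).re * (w j).re - (w i).im * (w j).im)
      = 2 * ∑ i, ∑ j, P.imC⁻¹ i j * ((w i).im * (w j).im) := by
    simp only [← Finset.sum_sub_distrib, Finset.mul_sum]
    refine Finset.sum_congr rfl fun i _ => Finset.sum_congr rfl fun j _ => ?_
    simp
    ring
  linarith

theorem re_I_mul_phase (z : Fin n → ℂ) (x : Fin n → ℝ) :
    (Complex.I * P.phase z x).re = P.weightForm z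
      - 1 / 2 * ((x + P.imC⁻¹ *ᵥ fun i => ((z ᵥ* P.B) i).im) ⬝ᵥ P.imC *ᵥ
          (x + P.imC⁻¹ *ᵥ fun i => ((z ᵥ* P.B) i).im)) := by
  have hu : IsUnit P.imC.det := P.imC_posDef.det_pos.ne'.isUnit
  rw [P.weightForm_eq, phase, Matrix.dotProduct_mulVec z P.B]
  generalize z ᵥ* P.B = w
  set y : Fin n → ℝ := fun i => (w i).im with hy
  have hB : (Complex.I * (w ⬝ᵥ fun i => (x i : ℂ))).re = -(y ⬝ᵥ x) := by
    simp [dotProduct, hy]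
  have hC : (Complex.I * (1 / 2 * ((fun i => (x i : ℂ)) ⬝ᵥ P.C *ᵥ fun i => (x i : ℂ)))).re
      = -(1 / 2 * (x ⬝ᵥ P.imC *ᵥ x)) := by
    have : (1 / 2 : ℂ) = ((1 / 2 : ℝ) : ℂ) := by norm_num
    rw [Complex.I_mul_re, this, Complex.im_ofReal_mul]
    simp [dotProduct, Matrix.mulVec, imC]
  have hxs : (P.imC⁻¹ *ᵥ y) ⬝ᵥ P.imC *ᵥ x = y ⬝ᵥ x := by
    rw [Matrix.dotProduct_mulVec, ← Matrix.mulVec_transpose, P.imC_symm, Matrix.mulVec_mulVec,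
      Matrix.mul_nonsing_inv _ hu, Matrix.one_mulVec]
  have hss : P.imC *ᵥ (P.imC⁻¹ *ᵥ y) = y := by
    rw [Matrix.mulVec_mulVec, Matrix.mul_nonsing_inv _ hu, Matrix.one_mulVec]
  rw [mul_add, mul_add, Complex.add_re, Complex.add_re, hB, hC, Matrix.mulVec_add, hss,
    add_dotProduct, dotProduct_add, dotProduct_add, hxs, dotProduct_comm x y,
    dotProduct_comm _ y]
  ring

theorem weight_isGreatest (z : Fin n → ℂ) :
    IsGreatest (Set.range fun x : Fin n → ℝ => (Complex.I * P.phase z x).re)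
      (P.weightForm z) := by
  constructor
  · refine ⟨-(P.imC⁻¹ *ᵥ fun i => ((z ᵥ* P.B) i).im), ?_⟩
    simp [P.re_I_mul_phase]
  · rintro _ ⟨x, rfl⟩
    simp only [P.re_I_mul_phase]
    have h := P.imC_posDef.posSemidef.dotProduct_mulVec_nonneg
      (x + P.imC⁻¹ *ᵥ fun i => ((z ᵥ* P.B) i).im)
    rw [star_trivial] at h
    linarith

theorem weight_eq (z : Fin n → ℂ) :
    P.weight z = (z ⬝ᵥ P.hessMixed *ᵥ star z).re + (z ⬝ᵥ P.hessHol *ᵥ z).re :=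
  (P.weight_isGreatest z).csSup_eq

theorem continuous_weight : Continuous P.weight := by
  have : P.weight = fun z => (z ⬝ᵥ P.hessMixed *ᵥ star z).re + (z ⬝ᵥ P.hessHol *ᵥ z).re :=
    funext P.weight_eq
  rw [this]
  simp only [dotProduct, Matrix.mulVec]
  fun_prop

/-- The measure `e^{-2Φ(z)} L(dz)` on `ℂⁿ`. -/
def weightMeasure : MeasureTheory.Measure (Fin n → ℂ) :=
  MeasureTheory.volume.withDensity fun z => ENNReal.ofReal (Real.exp (-2 * P.weight z))

/-- `Hol(ℂⁿ) ∩ L²_Φ(ℂⁿ)` as a space of functions. -/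
def holL2 : Submodule ℂ ((Fin n → ℂ) → ℂ) where
  carrier := {F | Differentiable ℂ F ∧ MeasureTheory.MemLp F 2 P.weightMeasure}
  add_mem' h₁ h₂ := ⟨h₁.1.add h₂.1, h₁.2.add h₂.2⟩
  zero_mem' := ⟨differentiable_const 0, MeasureTheory.MemLp.zero⟩
  smul_mem' c _ h := ⟨h.1.const_smul c, h.2.const_smul c⟩

/-- The Segal-Bargmann space `H_Φ(ℂⁿ)`. -/
def SegalBargmann : Type := P.holL2

instance : AddCommGroup P.SegalBargmann := inferInstanceAs (AddCommGroup P.holL2)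

instance : Module ℂ P.SegalBargmann := inferInstanceAs (Module ℂ P.holL2)

instance : CoeFun P.SegalBargmann fun _ => (Fin n → ℂ) → ℂ := ⟨fun F => F.1⟩

theorem ae_weightMeasure_iff {p : (Fin n → ℂ) → Prop} :
    (∀ᵐ z ∂P.weightMeasure, p z) ↔ ∀ᵐ z, p z := by
  have hm : Measurable fun z => ENNReal.ofReal (Real.exp (-2 * P.weight z)) := by
    have := P.continuous_weight
    fun_prop
  rw [weightMeasure, MeasureTheory.ae_withDensity_iff hm]
  simp [Real.exp_pos]

theorem integrable_conj_mul (F G : P.SegalBargmann) :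
    MeasureTheory.Integrable (fun z => starRingEnd ℂ (F z) * G z) P.weightMeasure :=
  MeasureTheory.MemLp.integrable_mul (p := 2) (q := 2) F.2.2.star G.2.2

/-- The inner product of `H_Φ(ℂⁿ)`, conjugate linear in the first variable. -/
@[reducible]
def innerCore : InnerProductSpace.Core ℂ P.SegalBargmann where
  inner F G := ∫ z, starRingEnd ℂ (F z) * G z ∂P.weightMeasure
  conj_inner_symm F G := by
    rw [← integral_conj]
    simp [mul_comm]
  re_inner_nonneg F := by
    have h : ∀ z, starRingEnd ℂ (F z) * F z = ((‖F z‖ ^ 2 : ℝ) : ℂ) := by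
      intro z
      rw [Complex.conj_mul', Complex.ofReal_pow]
    simp only [h]
    rw [integral_complex_ofReal]
    simp only [RCLike.re_to_complex, Complex.ofReal_re]
    exact MeasureTheory.integral_nonneg fun z => by positivity
  add_left F G H := by
    rw [← MeasureTheory.integral_add (P.integrable_conj_mul F H) (P.integrable_conj_mul G H)]
    refine MeasureTheory.integral_congr_ae (Filter.Eventually.of_forall fun z => ?_)
    change starRingEnd ℂ (F z + G z) * H z = _
    simp only [map_add]
    ring
  smul_left F G c := by
    rw [← MeasureTheory.integral_const_mul]
    refine MeasureTheory.integral_congr_ae (Filter.Eventually.of_forall fun z => ?_)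
    change starRingEnd ℂ (c * F z) * G z = _
    simp only [map_mul]
    ring
  definite F hF := by
    have h : ∀ z, starRingEnd ℂ (F z) * F z = ((‖F z‖ ^ 2 : ℝ) : ℂ) := by
      intro z
      rw [Complex.conj_mul', Complex.ofReal_pow]
    have hi := P.integrable_conj_mul F F
    simp only [h] at hF hi
    rw [integral_complex_ofReal, Complex.ofReal_eq_zero] at hF
    have hi' : MeasureTheory.Integrable (fun z => ‖F z‖ ^ 2) P.weightMeasure :=
      hi.re
    rw [MeasureTheory.integral_eq_zero_iff_of_nonneg (fun z => by positivity) hi'] at hF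
    have h0 : ∀ᵐ z, F z = 0 := by
      rw [← P.ae_weightMeasure_iff]
      filter_upwards [hF] with z hz
      simpa using hz
    have hc : Continuous fun z => F z := F.2.1.continuous
    have := (hc.ae_eq_iff_eq MeasureTheory.volume (continuous_const (y := (0 : ℂ)))).1 h0
    exact Subtype.ext this

instance : NormedAddCommGroup P.SegalBargmann := P.innerCore.toNormedAddCommGroup

instance : InnerProductSpace ℂ P.SegalBargmann := InnerProductSpace.ofCore P.innerCore.toCore

/-- An element of `Hol(ℂⁿ) ∩ L²_Φ(ℂⁿ)` viewed in `H_Φ(ℂⁿ)` (and `0` for any other function). -/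
def toSpace (F : (Fin n → ℂ) → ℂ) : P.SegalBargmann :=
  open scoped Classical in if h : F ∈ P.holL2 then ⟨F, h⟩ else 0

variable (Q : Matrix (Fin n) (Fin n) ℂ)

/-- The differential expression `Λᵢ F = ∂F/∂zᵢ + 2 (Qz)ᵢ F`. -/
def annihilationExpr (Q : Matrix (Fin n) (Fin n) ℂ) (i : Fin n) (F : (Fin n → ℂ) → ℂ) :
    (Fin n → ℂ) → ℂ :=
  fun z => fderiv ℂ F z (Pi.single i 1) + 2 * (Q *ᵥ z) i * F z

theorem annihilationExpr_add (i : Fin n) {F G : (Fin n → ℂ) → ℂ} (hF : Differentiable ℂ F)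
    (hG : Differentiable ℂ G) :
    annihilationExpr Q i (F + G) = annihilationExpr Q i F + annihilationExpr Q i G := by
  funext z
  simp only [annihilationExpr, Pi.add_apply]
  rw [fderiv_add (hF z) (hG z)]
  simp only [add_apply]
  ring

theorem annihilationExpr_smul (i : Fin n) (c : ℂ) {F : (Fin n → ℂ) → ℂ}
    (hF : Differentiable ℂ F) :
    annihilationExpr Q i (c • F) = c • annihilationExpr Q i F := by
  funext z
  simp only [annihilationExpr, Pi.smul_apply]
  rw [fderiv_const_smul (hF z)]
  simp only [smul_apply, smul_eq_mul]
  ring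

/-- The annihilation operator `Λᵢ` in `H_Φ(ℂⁿ)`, on its maximal domain
`{F ∈ H_Φ | Λᵢ F ∈ H_Φ}`. -/
def annihilation (i : Fin n) : P.SegalBargmann →ₗ.[ℂ] P.SegalBargmann where
  domain :=
    { carrier := {F | annihilationExpr Q i F ∈ P.holL2}
      add_mem' := by
        intro F G hF hG
        change annihilationExpr Q i (F.1 + G.1) ∈ P.holL2
        rw [annihilationExpr_add Q i F.2.1 G.2.1]
        exact P.holL2.add_mem hF hG
      zero_mem' := by
        change annihilationExpr Q i (0 : (Fin n → ℂ) → ℂ) ∈ P.holL2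
        have h := annihilationExpr_smul Q i 0 (F := 0) (differentiable_const (0 : ℂ))
        rw [zero_smul, zero_smul] at h
        rw [h]
        exact P.holL2.zero_mem
      smul_mem' := by
        intro c F hF
        change annihilationExpr Q i (c • F.1) ∈ P.holL2
        rw [annihilationExpr_smul Q i c F.2.1]
        exact P.holL2.smul_mem c hF }
  toFun :=
    { toFun := fun F => ⟨annihilationExpr Q i F.1, F.2⟩
      map_add' := fun F G => Subtype.ext (annihilationExpr_add Q i F.1.2.1 G.1.2.1)
      map_smul' := fun c F => Subtype.ext (annihilationExpr_smul Q i c F.1.2.1) }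

/-- The creation operator `Λᵢ*`: the Hilbert space adjoint of `Λᵢ`, i.e. `Λᵢ* G = K` when
`⟪G, Λᵢ F⟫ = ⟪K, F⟫` for all `F` in the domain of `Λᵢ`. -/
def creation (i : Fin n) : P.SegalBargmann →ₗ.[ℂ] P.SegalBargmann :=
  (P.annihilation Q i).graph.adjoint.toLinearPMap

/-- `Λᵢ* G` (and `0` if `G` is not in the domain of `Λᵢ*`). -/
def creationApply (i : Fin n) (G : P.SegalBargmann) : P.SegalBargmann :=
  open scoped Classical in
    if h : G ∈ (P.creation Q i).domain then P.creation Q i ⟨G, h⟩ else 0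

/-- The generator `ψ̃₀(z) = exp(-⟨z,Qz⟩)`, as an element of `H_Φ(ℂⁿ)`. -/
def generator : P.SegalBargmann := P.toSpace fun z => Complex.exp (-(z ⬝ᵥ Q *ᵥ z))

/-- `ψ̃_α = (Λ₁*)^{α₁} ⋯ (Λₙ*)^{αₙ} ψ̃₀`. -/
def hermite (α : Fin n → ℕ) : P.SegalBargmann :=
  (List.finRange n).foldr (fun i G => (P.creationApply Q i)^[α i] G) (P.generator Q)

/-- `ψ_α = ψ̃_α / (√((2ρ²)^{|α|} α!) ‖ψ̃₀‖)`. -/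
def hermiteNormalized (ρ : ℝ) (α : Fin n → ℕ) : P.SegalBargmann :=
  ((1 / (√((2 * ρ ^ 2) ^ (∑ i, α i) * ∏ i, ((α i).factorial : ℝ)) * ‖P.generator Q‖) : ℝ) : ℂ) •
    P.hermite Q α

/-- `μᵢ = √(λᵢ² - ρ²)`. -/
def mu {n : ℕ} (ρ : ℝ) (lam : Fin n → ℝ) (i : Fin n) : ℝ := √(lam i ^ 2 - ρ ^ 2)

/-- `Q = -Φ''_{zz} + U diag(μ) X diag(λ) ᵗU`. -/
def matQ (U X : Matrix (Fin n) (Fin n) ℂ) (ρ : ℝ) (lam : Fin n → ℝ) :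
    Matrix (Fin n) (Fin n) ℂ :=
  -P.hessHol + U * Matrix.diagonal (fun i => (mu ρ lam i : ℂ)) * X *
    Matrix.diagonal (fun i => (lam i : ℂ)) * Uᵀ

end BargmannPhase

end

/-! Write H for `P.hessMixed` and R for `Q + P.hessHol`. Multiplication by exp(-⟨z, Φ''_zz z⟩)
(`trivialize`) removes the pluriharmonic part of the weight: the space becomes that of entire
functions with weight exp(-2⟨z, H z̄⟩), the generator becomes exp(-⟨z, Rz⟩), and Λᵢ becomes ∂ᵢ +
2(Rz)ᵢ. On p·exp(-⟨z, Rz⟩) with p a polynomial, this operator is just p ↦ ∂ᵢp.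

The choice of Q makes the adjoint equally simple. The symmetric matrix S = U diag(μ/λ) X ᵗU
satisfies R = S ᵗH and H = ρ² + S R* (`gaussianPair_of_diagonalization`). Integration by parts moves
Λᵢ to multiplication by 2(H z̄ + Rz)ᵢ under the integral, and the two matrix identities turn this
factor into the action of cᵢ = 2ρ² zᵢ + ∑ₖ Tᵢₖ ∂ₖ, with T = S*, on the other entry
(`integral_creationPoly`). Since [∂ᵢ, cⱼ] = 2ρ² δᵢⱼ, the cᵢ commute and ∂ᵢ1 = 0, the usual ladder
computation gives orthogonality and norms (`inner_hermitePoly`), and the cᵢ generate all polynomials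
from 1 (`span_hermitePoly`).

Three analytic facts complete the argument. The space is complete, because point evaluations are
given by a reproducing kernel (`completeSpace`). Polynomials times the generator are total: |⟨z,
Rz⟩| ≤ k⟨z, H z̄⟩ with k < 1 leaves room for an analytic continuation from the Gaussian to the
kernel (`eq_zero_of_forall_integral_eq_zero`). Finally cᵢ is the true adjoint against the whole
maximal domain of Λᵢ, not only against polynomials (`inner_polyElt_annihilation`). -/

open MeasureTheory

noncomputable section

/-! ### Gaussian integrability and sub-Gaussian growth. -/

/-- The squared Euclidean norm on `ℂⁿ`. -/
def sqNorm {n : ℕ} (z : Fin n → ℂ) : ℝ := ∑ i, ‖z i‖ ^ 2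

section sqNorm

variable {n : ℕ}

@[fun_prop]
theorem continuous_sqNorm : Continuous (sqNorm : (Fin n → ℂ) → ℝ) := by
  unfold sqNorm
  fun_prop

theorem sqNorm_nonneg (z : Fin n → ℂ) : 0 ≤ sqNorm z :=
  Finset.sum_nonneg fun i _ => by positivity

theorem norm_apply_sq_le_sqNorm (z : Fin n → ℂ) (i : Fin n) : ‖z i‖ ^ 2 ≤ sqNorm z :=
  Finset.single_le_sum (f := fun i => ‖z i‖ ^ 2) (fun i _ => by positivity) (Finset.mem_univ i)

theorem norm_sq_le_sqNorm (z : Fin n → ℂ) : ‖z‖ ^ 2 ≤ sqNorm z := by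
  have h : ‖z‖ ≤ √(sqNorm z) := by
    refine (pi_norm_le_iff_of_nonneg (Real.sqrt_nonneg _)).2 fun i => ?_
    exact Real.le_sqrt_of_sq_le (norm_apply_sq_le_sqNorm z i)
  calc ‖z‖ ^ 2 ≤ √(sqNorm z) ^ 2 := by gcongr
    _ = sqNorm z := Real.sq_sqrt (sqNorm_nonneg z)

/-- Linear growth is absorbed by quadratic growth. -/
theorem mul_norm_le_sqNorm (C : ℝ) {ε : ℝ} (hε : 0 < ε) (z : Fin n → ℂ) :
    C * ‖z‖ ≤ ε * sqNorm z + C ^ 2 / (4 * ε) := by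
  have h1 : ε * ‖z‖ ^ 2 ≤ ε * sqNorm z := by gcongr; exact norm_sq_le_sqNorm z
  have h2 : C * ‖z‖ ≤ ε * ‖z‖ ^ 2 + C ^ 2 / (4 * ε) := by
    rw [← sub_nonneg]
    have : ε * ‖z‖ ^ 2 + C ^ 2 / (4 * ε) - C * ‖z‖ = (2 * ε * ‖z‖ - C) ^ 2 / (4 * ε) := by
      field_simp
      ring
    rw [this]
    positivity
  linarith

theorem integrable_exp_neg_sqNorm {ε : ℝ} (hε : 0 < ε) :
    Integrable fun z : Fin n → ℂ => Real.exp (-ε * sqNorm z) := by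
  have h1 : Integrable fun w : ℂ => Real.exp (-ε * ‖w‖ ^ 2) := by
    have := (GaussianFourier.integrable_cexp_neg_mul_sq_norm_add (V := ℂ) (b := (ε : ℂ))
      (by simpa using hε) 0 0).norm
    refine this.congr (Filter.Eventually.of_forall fun w => ?_)
    simp only [Complex.norm_exp]
    congr 1
    simp [← Complex.ofReal_pow]
  have h2 := Integrable.fintype_prod (f := fun (_ : Fin n) (w : ℂ) => Real.exp (-ε * ‖w‖ ^ 2))
    (μ := fun _ => volume) (fun _ => h1)
  refine h2.congr (Filter.Eventually.of_forall fun z => ?_)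
  simp only [sqNorm, Finset.mul_sum, Real.exp_sum]

/-- Growth slower than every Gaussian. -/
def SubGaussian (u : (Fin n → ℂ) → ℂ) : Prop :=
  Continuous u ∧ ∀ ε > 0, ∃ C, 0 ≤ C ∧ ∀ z, ‖u z‖ ≤ C * Real.exp (ε * sqNorm z)

namespace SubGaussian

variable {u v : (Fin n → ℂ) → ℂ}

theorem const (c : ℂ) : SubGaussian fun _ : Fin n → ℂ => c := by
  refine ⟨continuous_const, fun ε hε => ⟨‖c‖, norm_nonneg _, fun z => ?_⟩⟩
  refine le_mul_of_one_le_right (norm_nonneg _) (Real.one_le_exp ?_)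
  exact mul_nonneg hε.le (sqNorm_nonneg z)

theorem add (hu : SubGaussian u) (hv : SubGaussian v) : SubGaussian fun z => u z + v z := by
  refine ⟨hu.1.add hv.1, fun ε hε => ?_⟩
  obtain ⟨C, hC, h1⟩ := hu.2 ε hε
  obtain ⟨D, hD, h2⟩ := hv.2 ε hε
  refine ⟨C + D, by positivity, fun z => (norm_add_le _ _).trans ?_⟩
  linarith [h1 z, h2 z, add_mul C D (Real.exp (ε * sqNorm z))]

theorem mul (hu : SubGaussian u) (hv : SubGaussian v) : SubGaussian fun z => u z * v z := by
  refine ⟨hu.1.mul hv.1, fun ε hε => ?_⟩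
  obtain ⟨C, hC, h1⟩ := hu.2 (ε / 2) (by positivity)
  obtain ⟨D, hD, h2⟩ := hv.2 (ε / 2) (by positivity)
  refine ⟨C * D, by positivity, fun z => ?_⟩
  rw [norm_mul]
  calc ‖u z‖ * ‖v z‖ ≤ (C * Real.exp (ε / 2 * sqNorm z)) * (D * Real.exp (ε / 2 * sqNorm z)) :=
        mul_le_mul (h1 z) (h2 z) (norm_nonneg _) (by positivity)
    _ = C * D * (Real.exp (ε / 2 * sqNorm z) * Real.exp (ε / 2 * sqNorm z)) := by ring
    _ = C * D * Real.exp (ε * sqNorm z) := by rw [← Real.exp_add]; ring_nf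

theorem star (hu : SubGaussian u) : SubGaussian fun z => starRingEnd ℂ (u z) :=
  ⟨Complex.continuous_conj.comp hu.1, fun ε hε => by simpa using hu.2 ε hε⟩

theorem sum {ι : Type*} (s : Finset ι) {w : ι → (Fin n → ℂ) → ℂ}
    (h : ∀ i ∈ s, SubGaussian (w i)) : SubGaussian fun z => ∑ i ∈ s, w i z := by
  classical
  induction s using Finset.induction_on with
  | empty => simpa using const 0
  | insert a s ha ih =>
    simp only [Finset.sum_insert ha]
    exact (h a (by simp)).add (ih fun i hi => h i (by simp [hi]))

theorem of_le_exp_norm (hu : Continuous u) {C D : ℝ} (hC : 0 ≤ C)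
    (h : ∀ z, ‖u z‖ ≤ C * Real.exp (D * ‖z‖)) : SubGaussian u := by
  refine ⟨hu, fun ε hε => ⟨C * Real.exp (D ^ 2 / (4 * ε)), by positivity, fun z => (h z).trans ?_⟩⟩
  rw [mul_assoc, ← Real.exp_add]
  gcongr
  linarith [mul_norm_le_sqNorm D hε z]

theorem eval (i : Fin n) : SubGaussian fun z : Fin n → ℂ => z i := by
  refine of_le_exp_norm (C := 1) (D := 1) (continuous_apply i) zero_le_one fun z => ?_
  have := Real.add_one_le_exp ‖z‖
  rw [one_mul, one_mul]
  linarith [norm_le_pi_norm z i]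

theorem mulVec (M : Matrix (Fin n) (Fin n) ℂ) (i : Fin n) :
    SubGaussian fun z : Fin n → ℂ => (M *ᵥ z) i := by
  simp only [Matrix.mulVec, dotProduct]
  exact sum _ fun j _ => (const _).mul (eval j)

theorem mulVec_star (M : Matrix (Fin n) (Fin n) ℂ) (i : Fin n) :
    SubGaussian fun z : Fin n → ℂ => (M *ᵥ Star.star z) i := by
  simp only [Matrix.mulVec, dotProduct]
  exact sum _ fun j _ => (const _).mul (eval j).star

theorem mvPolynomial (p : MvPolynomial (Fin n) ℂ) :
    SubGaussian fun z => MvPolynomial.eval z p := by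
  induction p using MvPolynomial.induction_on with
  | C a => simpa using const a
  | add p q hp hq => simpa using hp.add hq
  | mul_X p i hp => simpa using hp.mul (eval i)

end SubGaussian

theorem memLp_two_of_le_gaussian {f : (Fin n → ℂ) → ℂ} (hf : AEStronglyMeasurable f volume)
    {C ε : ℝ} (hε : 0 < ε) (h : ∀ z, ‖f z‖ ≤ C * Real.exp (-ε * sqNorm z)) :
    MemLp f 2 volume := by
  rw [memLp_two_iff_integrable_sq_norm hf]
  refine ((integrable_exp_neg_sqNorm (n := n) (ε := 2 * ε) (by positivity)).const_mul
    (C ^ 2)).mono' (hf.norm.pow 2) (Filter.Eventually.of_forall fun z => ?_)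
  rw [norm_pow, norm_norm]
  calc ‖f z‖ ^ 2 ≤ (C * Real.exp (-ε * sqNorm z)) ^ 2 := by gcongr; exact h z
    _ = C ^ 2 * Real.exp (-(2 * ε) * sqNorm z) := by
      rw [mul_pow, ← Real.exp_nat_mul]
      ring_nf

/-- A sub-Gaussian function times a Gaussian is square-integrable. -/
theorem SubGaussian.memLp_mul {u g : (Fin n → ℂ) → ℂ} (hu : SubGaussian u) (hg : Continuous g)
    {C ε : ℝ} (hε : 0 < ε) (h : ∀ z, ‖g z‖ ≤ C * Real.exp (-ε * sqNorm z)) :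
    MemLp (fun z => u z * g z) 2 volume := by
  obtain ⟨D, hD, h1⟩ := hu.2 (ε / 2) (by positivity)
  refine memLp_two_of_le_gaussian (C := D * C) (ε := ε / 2)
    (hu.1.mul hg).aestronglyMeasurable (by positivity) fun z => ?_
  rw [norm_mul]
  calc ‖u z‖ * ‖g z‖ ≤ (D * Real.exp (ε / 2 * sqNorm z)) * (C * Real.exp (-ε * sqNorm z)) :=
        mul_le_mul (h1 z) (h z) (norm_nonneg _) (by positivity)
    _ = D * C * (Real.exp (ε / 2 * sqNorm z) * Real.exp (-ε * sqNorm z)) := by ring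
    _ = D * C * Real.exp (-(ε / 2) * sqNorm z) := by rw [← Real.exp_add]; ring_nf

end sqNorm

/-! ### The mean value property for circularly symmetric densities. -/

section MeanValue

variable {n : ℕ}

theorem measurePreserving_unit_smul (c : ℂ) (hc : ‖c‖ = 1) :
    MeasurePreserving (fun z : Fin n → ℂ => c • z) volume volume := by
  have h1 : MeasurePreserving (fun w : ℂ => c * w) volume volume :=
    (rotation ⟨c, mem_sphere_zero_iff_norm.2 hc⟩).measurePreserving
  exact volume_preserving_pi (fun _ : Fin n => h1)

/-- Mean value property against a circularly symmetric density. -/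
theorem integral_mul_circular {f χ : (Fin n → ℂ) → ℂ} (hf : Differentiable ℂ f)
    (hχ : Continuous χ) (hrot : ∀ c : ℂ, ‖c‖ = 1 → ∀ z, χ (c • z) = χ z)
    (hint : Integrable fun z => f z * χ z) :
    ∫ z, f z * χ z = f 0 * ∫ z, χ z := by
  have hinv : ∀ c : ℂ, ‖c‖ = 1 → ∀ g : (Fin n → ℂ) → ℂ, ∫ z, g (c • z) = ∫ z, g z := by
    intro c hc g
    have hc0 : c ≠ 0 := by rintro rfl; simp at hc
    exact (measurePreserving_unit_smul c hc).integral_comp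
      (Homeomorph.smulOfNeZero c hc0).measurableEmbedding g
  have hcm : ∀ θ : ℝ, ‖circleMap 0 1 θ‖ = 1 := fun θ => by simp
  set G : ℝ → (Fin n → ℂ) → ℂ := fun θ z => f (circleMap 0 1 θ • z) * χ z with hG
  have hGeq : ∀ θ z, G θ z = f (circleMap 0 1 θ • z) * χ (circleMap 0 1 θ • z) := by
    intro θ z
    rw [hG, hrot _ (hcm θ)]
  have hGint : ∀ θ, ∫ z, G θ z = ∫ z, f z * χ z := by
    intro θ
    simp only [hGeq]
    exact hinv _ (hcm θ) fun z => f z * χ z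
  have hGcont : Continuous (Function.uncurry G) := by
    have := hf.continuous
    have := (continuous_circleMap 0 1)
    simp only [hG, Function.uncurry_def]
    fun_prop
  have hGi : ∀ θ, Integrable (G θ) := by
    intro θ
    have := (measurePreserving_unit_smul (n := n) _ (hcm θ)).integrable_comp_of_integrable hint
    refine this.congr (Filter.Eventually.of_forall fun z => ?_)
    simp [hGeq]
  have hGn : ∀ θ, ∫ z, ‖G θ z‖ = ∫ z, ‖f z * χ z‖ := by
    intro θ
    have := hinv _ (hcm θ) fun z => ((‖f z * χ z‖ : ℝ) : ℂ)
    simp only [integral_complex_ofReal, Complex.ofReal_inj] at this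
    simpa only [hGeq] using this
  have hprod : Integrable (Function.uncurry G)
      ((volume.restrict (Set.uIoc 0 (2 * Real.pi))).prod volume) := by
    rw [integrable_prod_iff hGcont.aestronglyMeasurable]
    refine ⟨Filter.Eventually.of_forall fun θ => hGi θ, ?_⟩
    simp only [Function.uncurry_apply_pair, hGn]
    have : IsFiniteMeasure (volume.restrict (Set.uIoc 0 (2 * Real.pi))) := by
      rw [Set.uIoc_of_le (by positivity)]
      infer_instance
    exact integrable_const _
  have hswap := intervalIntegral_integral_swap hprod
  simp only [hGint] at hswap
  rw [intervalIntegral.integral_const] at hswap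
  -- For fixed z this is the one-variable mean value property of c ↦ f(cz) on the unit circle;
  -- `hswap` has already exchanged the average over rotations with the integral over z.
  have hmean : ∀ z, ∫ θ in (0 : ℝ)..(2 * Real.pi), G θ z = (2 * Real.pi : ℂ) * (f 0 * χ z) := by
    intro z
    have hd : Differentiable ℂ fun c : ℂ => f (c • z) := by fun_prop
    have h := DiffContOnCl.circleAverage (f := fun c : ℂ => f (c • z)) (c := 0) (R := 1)
      hd.diffContOnCl
    simp only [hG]
    rw [intervalIntegral.integral_mul_const]
    rw [Real.circleAverage_def] at h
    simp only [zero_smul] at h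
    rw [← h]
    simp
    field_simp
  simp only [hmean] at hswap
  rw [integral_const_mul, integral_const_mul] at hswap
  have hpi : (2 * Real.pi : ℂ) ≠ 0 := by
    simp [Real.pi_ne_zero]
  simp only [sub_zero, Complex.real_smul, Complex.ofReal_mul, Complex.ofReal_ofNat] at hswap
  exact mul_left_cancel₀ hpi hswap

end MeanValue

/-! ### The weight exp(-2⟨z, H z̄⟩) and its reproducing kernel. -/

section HermForm

variable {n : ℕ}

theorem norm_dotProduct_mulVec_le (M : Matrix (Fin n) (Fin n) ℂ) (a v : Fin n → ℂ) :
    ‖a ⬝ᵥ M *ᵥ v‖ ≤ (∑ i, ∑ j, ‖M i j‖) * ‖a‖ * ‖v‖ := by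
  simp only [dotProduct, Matrix.mulVec, Finset.mul_sum, Finset.sum_mul]
  refine (norm_sum_le _ _).trans (Finset.sum_le_sum fun i _ => ?_)
  refine (norm_sum_le _ _).trans (Finset.sum_le_sum fun j _ => ?_)
  rw [norm_mul, norm_mul]
  calc ‖a i‖ * (‖M i j‖ * ‖v j‖) ≤ ‖a‖ * (‖M i j‖ * ‖v‖) := by
        gcongr
        · exact norm_le_pi_norm a i
        · exact norm_le_pi_norm v j
    _ = ‖M i j‖ * ‖a‖ * ‖v‖ := by ring

theorem norm_star_pi (z : Fin n → ℂ) : ‖star z‖ = ‖z‖ := norm_star z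

/-- The sesquilinear form `⟨a, H z̄⟩`. -/
def sesq (H : Matrix (Fin n) (Fin n) ℂ) (a z : Fin n → ℂ) : ℂ := a ⬝ᵥ H *ᵥ star z

/-- The real quadratic form `Re ⟨z, H z̄⟩`. -/
def hermForm (H : Matrix (Fin n) (Fin n) ℂ) (z : Fin n → ℂ) : ℝ := (sesq H z z).re

/-- The square root of the Gaussian density attached to `H`. -/
def gauss (H : Matrix (Fin n) (Fin n) ℂ) (z : Fin n → ℂ) : ℂ :=
  ((Real.exp (-hermForm H z) : ℝ) : ℂ)

/-- `H` is Hermitian and positive definite, in quantitative form. -/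
def IsPosHerm (H : Matrix (Fin n) (Fin n) ℂ) : Prop :=
  H.IsHermitian ∧ ∃ c, 0 < c ∧ ∀ z, c * sqNorm z ≤ hermForm H z

variable {H : Matrix (Fin n) (Fin n) ℂ}

theorem continuous_sesq : Continuous fun p : (Fin n → ℂ) × (Fin n → ℂ) => sesq H p.1 p.2 := by
  simp only [sesq, dotProduct, Matrix.mulVec]
  fun_prop

theorem sesq_add_left (a b z : Fin n → ℂ) : sesq H (a + b) z = sesq H a z + sesq H b z :=
  add_dotProduct _ _ _

theorem sesq_add_right (a z w : Fin n → ℂ) : sesq H a (z + w) = sesq H a z + sesq H a w := by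
  simp only [sesq, star_add, Matrix.mulVec_add, dotProduct_add]

theorem conj_sesq (hH : H.IsHermitian) (a z : Fin n → ℂ) :
    starRingEnd ℂ (sesq H a z) = sesq H z a := by
  have h : ∀ i j, starRingEnd ℂ (H i j) = H j i := fun i j => by
    simpa using congrFun (congrFun hH j) i
  simp only [sesq, dotProduct, Matrix.mulVec, Finset.mul_sum, map_sum, map_mul]
  rw [Finset.sum_comm]
  refine Finset.sum_congr rfl fun i _ => Finset.sum_congr rfl fun j _ => ?_
  simp [h]
  ring

theorem ofReal_hermForm (hH : H.IsHermitian) (z : Fin n → ℂ) :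
    ((hermForm H z : ℝ) : ℂ) = sesq H z z :=
  Complex.conj_eq_iff_re.1 (conj_sesq hH z z)

theorem norm_sesq_le (H : Matrix (Fin n) (Fin n) ℂ) (a z : Fin n → ℂ) :
    ‖sesq H a z‖ ≤ (∑ i, ∑ j, ‖H i j‖) * ‖a‖ * ‖z‖ := by
  rw [← norm_star_pi z]
  exact norm_dotProduct_mulVec_le H a (star z)

@[fun_prop]
theorem continuous_hermForm : Continuous (hermForm H) :=
  Complex.continuous_re.comp (continuous_sesq.comp (continuous_id.prodMk continuous_id))

@[fun_prop]
theorem continuous_gauss : Continuous (gauss H) := by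
  unfold gauss
  fun_prop

theorem norm_gauss (z : Fin n → ℂ) : ‖gauss H z‖ = Real.exp (-hermForm H z) := by
  rw [gauss, Complex.norm_real, Real.norm_of_nonneg (Real.exp_pos _).le]

theorem gauss_ne_zero (z : Fin n → ℂ) : gauss H z ≠ 0 := by
  rw [← norm_pos_iff, norm_gauss]
  exact Real.exp_pos _

theorem conj_gauss (z : Fin n → ℂ) : starRingEnd ℂ (gauss H z) = gauss H z :=
  Complex.conj_ofReal _

theorem gauss_sq (hH : H.IsHermitian) (z : Fin n → ℂ) :
    gauss H z ^ 2 = Complex.exp (-2 * sesq H z z) := by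
  rw [gauss, Complex.ofReal_exp, ← Complex.exp_nat_mul, ← ofReal_hermForm hH]
  push_cast
  ring_nf

theorem sesq_smul_smul (c : ℂ) (hc : ‖c‖ = 1) (z : Fin n → ℂ) :
    sesq H (c • z) (c • z) = sesq H z z := by
  have h : c * starRingEnd ℂ c = 1 := by rw [Complex.mul_conj, Complex.normSq_eq_norm_sq, hc]; simp
  simp only [sesq, star_smul, Matrix.mulVec_smul, smul_dotProduct, dotProduct_smul, smul_eq_mul]
  rw [← mul_assoc, mul_comm (star c) c]
  change c * starRingEnd ℂ c * _ = _
  rw [h, one_mul]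

theorem gauss_smul (c : ℂ) (hc : ‖c‖ = 1) (z : Fin n → ℂ) : gauss H (c • z) = gauss H z := by
  rw [gauss, gauss, hermForm, sesq_smul_smul c hc, hermForm]

/-- The reproducing kernel, up to normalization. -/
theorem subGaussian_exp_sesq (a : Fin n → ℂ) :
    SubGaussian fun z => Complex.exp (2 * sesq H a z) := by
  refine SubGaussian.of_le_exp_norm (C := 1) (D := 2 * ((∑ i, ∑ j, ‖H i j‖) * ‖a‖)) ?_
    zero_le_one fun z => ?_
  · have := (continuous_sesq (H := H)).comp (continuous_const.prodMk continuous_id :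
      Continuous fun z : Fin n → ℂ => (a, z))
    exact Complex.continuous_exp.comp (continuous_const.mul this)
  · rw [one_mul]
    refine (Complex.norm_exp_le_exp_norm _).trans (Real.exp_le_exp.2 ?_)
    rw [norm_mul, Complex.norm_ofNat, mul_assoc]
    gcongr
    exact norm_sesq_le H a z

theorem SubGaussian.memLp_mul_gauss (hH : IsPosHerm H) {u : (Fin n → ℂ) → ℂ}
    (hu : SubGaussian u) : MemLp (fun z => u z * gauss H z) 2 volume := by
  obtain ⟨-, c, hc, h⟩ := hH
  refine hu.memLp_mul (C := 1) continuous_gauss hc fun z => ?_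
  rw [norm_gauss, one_mul]
  exact Real.exp_le_exp.2 (by linarith [h z])

theorem integrable_mul_gauss_sq {f g : (Fin n → ℂ) → ℂ}
    (hf : MemLp (fun z => f z * gauss H z) 2 volume)
    (hg : MemLp (fun z => g z * gauss H z) 2 volume) :
    Integrable fun z => f z * g z * gauss H z ^ 2 := by
  refine (hf.integrable_mul hg).congr (Filter.Eventually.of_forall fun z => ?_)
  simp only [Pi.mul_apply]
  ring

theorem integral_gauss_sq_ne_zero (hH : IsPosHerm H) : ∫ z, gauss H z ^ 2 ≠ 0 := by
  have h : ∀ z, gauss H z ^ 2 = ((Real.exp (-hermForm H z) ^ 2 : ℝ) : ℂ) := by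
    intro z
    simp [gauss]
  have hi : Integrable fun z => gauss H z ^ 2 := by
    have := (SubGaussian.const (n := n) 1).memLp_mul_gauss hH
    simpa using integrable_mul_gauss_sq this this
  simp only [h] at hi ⊢
  rw [integral_complex_ofReal, Complex.ofReal_ne_zero]
  have hi2 : Integrable fun z => Real.exp (-hermForm H z) ^ 2 := hi.re
  refine ne_of_gt ((integral_pos_iff_support_of_nonneg (fun z => by positivity) hi2).2 ?_)
  have : (Function.support fun z => Real.exp (-hermForm H z) ^ 2) = Set.univ := by
    ext z
    simp [(Real.exp_pos _).ne']
  rw [this]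
  exact Measure.measure_univ_pos.2 (NeZero.ne _)

/-- The reproducing property. -/
theorem integral_exp_sesq (hH : IsPosHerm H) {f : (Fin n → ℂ) → ℂ} (hf : Differentiable ℂ f)
    (hf2 : MemLp (fun z => f z * gauss H z) 2 volume) (a : Fin n → ℂ) :
    ∫ z, f z * Complex.exp (2 * sesq H a z) * gauss H z ^ 2 = f a * ∫ z, gauss H z ^ 2 := by
  have hi := integrable_mul_gauss_sq hf2 ((subGaussian_exp_sesq (H := H) a).memLp_mul_gauss hH)
  -- After translation by a the kernel cancels the part of the exponent that is antiholomorphic and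
  -- linear in z. What remains beside the centred Gaussian is holomorphic in z and equals f(a) at z
  -- = 0, so the mean value property applies.
  have key : ∀ z, f (z + a) * Complex.exp (2 * sesq H a (z + a)) * gauss H (z + a) ^ 2
      = (f (z + a) * Complex.exp (-2 * sesq H z a)) * gauss H z ^ 2 := by
    intro z
    rw [gauss_sq hH.1, gauss_sq hH.1, mul_assoc, mul_assoc, ← Complex.exp_add, ← Complex.exp_add]
    simp only [sesq_add_left, sesq_add_right]
    ring_nf
  rw [← integral_add_right_eq_self _ a]
  have hi' := hi.comp_add_right a
  simp only [key] at hi' ⊢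
  rw [integral_mul_circular (f := fun z => f (z + a) * Complex.exp (-2 * sesq H z a)) _ _ _ hi']
  · simp [sesq]
  · simp only [sesq, dotProduct]
    fun_prop
  · fun_prop
  · intro c hc z
    rw [gauss_smul c hc]

/-- The linear form `a ↦ ⟨a, H z̄⟩`. -/
def sesqCLM (H : Matrix (Fin n) (Fin n) ℂ) (z : Fin n → ℂ) : (Fin n → ℂ) →L[ℂ] ℂ :=
  ∑ i, (H *ᵥ star z) i • ContinuousLinearMap.proj i

theorem sesqCLM_apply (a z : Fin n → ℂ) : sesqCLM H z a = sesq H a z := by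
  simp [sesqCLM, sesq, dotProduct, mul_comm]

theorem continuous_sesqCLM : Continuous (sesqCLM H) := by
  unfold sesqCLM Matrix.mulVec dotProduct
  fun_prop

theorem norm_sesqCLM_le (z : Fin n → ℂ) : ‖sesqCLM H z‖ ≤ (∑ i, ∑ j, ‖H i j‖) * ‖z‖ := by
  refine ContinuousLinearMap.opNorm_le_bound _ (by positivity) fun a => ?_
  rw [sesqCLM_apply]
  linarith [norm_sesq_le H a z, mul_right_comm (∑ i, ∑ j, ‖H i j‖) ‖a‖ ‖z‖]

/-- The projection of an `L²` function onto the weighted Bergman space is entire. -/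
theorem differentiable_integral_exp_sesq (hH : IsPosHerm H) {g : (Fin n → ℂ) → ℂ}
    (hg : MemLp (fun z => g z * gauss H z) 2 volume) :
    Differentiable ℂ fun a => ∫ z, g z * Complex.exp (2 * sesq H a z) * gauss H z ^ 2 := by
  intro a₀
  set D := ∑ i, ∑ j, ‖H i j‖ with hD
  have hD0 : 0 ≤ D := by positivity
  have hk : ∀ a, MemLp (fun z => Complex.exp (2 * sesq H a z) * gauss H z) 2 volume := fun a =>
    (subGaussian_exp_sesq (H := H) a).memLp_mul_gauss hH
  -- A bound for the kernel times its derivative in a, uniform for a in the unit ball around a₀; the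
  -- factor exp ‖z‖ dominates the linear factor brought down by differentiation.
  set β : (Fin n → ℂ) → ℂ := fun z =>
    (Real.exp (2 * (D * (‖a₀‖ + 1)) * ‖z‖) * (2 * D * Real.exp ‖z‖) : ℝ) with hβ
  have hβs : SubGaussian β := by
    refine SubGaussian.of_le_exp_norm (C := 2 * D) (D := 2 * (D * (‖a₀‖ + 1)) + 1) (by fun_prop)
      (by positivity) fun z => ?_
    rw [hβ, Complex.norm_real, Real.norm_of_nonneg (by positivity), add_mul, Real.exp_add, one_mul]
    linarith
  have hbi := integrable_mul_gauss_sq hg (hβs.memLp_mul_gauss hH)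
  refine (hasFDerivAt_integral_of_dominated_of_fderiv_le (s := Metric.ball a₀ 1)
    (F' := fun a z => (g z * Complex.exp (2 * sesq H a z) * gauss H z ^ 2) •
      ((2 : ℂ) • sesqCLM H z)) (Metric.ball_mem_nhds a₀ one_pos)
    (Filter.Eventually.of_forall fun a => (integrable_mul_gauss_sq hg (hk a)).aestronglyMeasurable)
    (integrable_mul_gauss_sq hg (hk a₀))
    ((integrable_mul_gauss_sq hg (hk a₀)).aestronglyMeasurable.smul
      (continuous_sesqCLM.const_smul (2 : ℂ)).aestronglyMeasurable)
    (Filter.Eventually.of_forall fun z a ha => ?_) hbi.norm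
    (Filter.Eventually.of_forall fun z a _ => ?_)).differentiableAt
  · rw [norm_smul, norm_mul, norm_mul, norm_mul, norm_mul, norm_smul, Complex.norm_ofNat]
    have ha' : ‖a‖ ≤ ‖a₀‖ + 1 := by
      rw [Metric.mem_ball, dist_eq_norm] at ha
      linarith [norm_le_insert' a a₀]
    have h1 : ‖Complex.exp (2 * sesq H a z)‖ ≤ Real.exp (2 * (D * (‖a₀‖ + 1)) * ‖z‖) := by
      refine (Complex.norm_exp_le_exp_norm _).trans (Real.exp_le_exp.2 ?_)
      rw [norm_mul, Complex.norm_ofNat, mul_assoc]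
      have := norm_sesq_le H a z
      rw [← hD] at this
      have h2 : D * ‖a‖ * ‖z‖ ≤ D * (‖a₀‖ + 1) * ‖z‖ := by gcongr
      linarith
    have h2 : 2 * ‖sesqCLM H z‖ ≤ 2 * D * Real.exp ‖z‖ := by
      have h3 := norm_sesqCLM_le (H := H) z
      rw [← hD] at h3
      have h4 : D * ‖z‖ ≤ D * Real.exp ‖z‖ := by
        gcongr
        linarith [Real.add_one_le_exp ‖z‖]
      linarith
    rw [hβ, Complex.norm_real, Real.norm_of_nonneg (by positivity)]
    calc ‖g z‖ * ‖Complex.exp (2 * sesq H a z)‖ * ‖gauss H z ^ 2‖ * (2 * ‖sesqCLM H z‖)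
        ≤ ‖g z‖ * Real.exp (2 * (D * (‖a₀‖ + 1)) * ‖z‖) * ‖gauss H z ^ 2‖
            * (2 * D * Real.exp ‖z‖) := by gcongr
      _ = _ := by ring
  · have h1 : HasFDerivAt (fun a => 2 * sesq H a z) ((2 : ℂ) • sesqCLM H z) a := by
      simp only [← sesqCLM_apply]
      exact (sesqCLM H z).hasFDerivAt.const_mul 2
    have h2 := (h1.cexp.const_mul (g z)).mul_const (gauss H z ^ 2)
    refine h2.congr_fderiv ?_
    rw [smul_smul, smul_smul]
    congr 1
    ring

end HermForm

/-! ### Totality of polynomials times a Gaussian. -/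

section Density

variable {n : ℕ}

/-- The Taylor series at t₀ is zero, and the identity theorem spreads this over the ball. The
derivatives are supplied as a sequence because they will be parameter integrals in closed form. -/
theorem eq_zero_of_hasDerivAt_of_eq_zero {g : ℕ → ℂ → ℂ} {c t₀ : ℂ} {r : ℝ}
    (hg : ∀ m, ∀ t ∈ Metric.ball c r, HasDerivAt (g m) (g (m + 1) t) t)
    (ht₀ : t₀ ∈ Metric.ball c r) (h0 : ∀ m, g m t₀ = 0) {t : ℂ} (ht : t ∈ Metric.ball c r) :
    g 0 t = 0 := by
  have hd : DifferentiableOn ℂ (g 0) (Metric.ball c r) := fun t ht =>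
    (hg 0 t ht).differentiableAt.differentiableWithinAt
  have hit : ∀ m, ∀ t ∈ Metric.ball c r, iteratedDeriv m (g 0) t = g m t := by
    intro m
    induction m with
    | zero => simp
    | succ m ih =>
      intro t ht
      rw [iteratedDeriv_succ]
      have : iteratedDeriv m (g 0) =ᶠ[nhds t] g m := by
        filter_upwards [Metric.isOpen_ball.mem_nhds ht] with s hs using ih s hs
      rw [this.deriv_eq, (hg m t ht).deriv]
  refine (hd.analyticOnNhd Metric.isOpen_ball).eqOn_zero_of_preconnected_of_eventuallyEq_zero
    (convex_ball c r).isPreconnected ht₀ ?_ ht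
  obtain ⟨δ, hδ, hsub⟩ := Metric.isOpen_iff.1 Metric.isOpen_ball t₀ ht₀
  filter_upwards [Metric.ball_mem_nhds t₀ hδ] with s hs
  have := Complex.hasSum_taylorSeries_on_ball (hd.mono hsub) hs
  simp only [hit _ t₀ ht₀, h0, smul_zero] at this
  exact this.unique hasSum_zero

variable {H R : Matrix (Fin n) (Fin n) ℂ}

/-- The quadratic form of a matrix as a polynomial. -/
def quadPoly (M : Matrix (Fin n) (Fin n) ℂ) : MvPolynomial (Fin n) ℂ :=
  ∑ i, ∑ j, MvPolynomial.C (M i j) * MvPolynomial.X i * MvPolynomial.X j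

theorem eval_quadPoly (M : Matrix (Fin n) (Fin n) ℂ) (z : Fin n → ℂ) :
    MvPolynomial.eval z (quadPoly M) = z ⬝ᵥ M *ᵥ z := by
  simp only [quadPoly, map_sum, map_mul, MvPolynomial.eval_C, MvPolynomial.eval_X, dotProduct,
    Matrix.mulVec, Finset.mul_sum]
  refine Finset.sum_congr rfl fun i _ => Finset.sum_congr rfl fun j _ => ?_
  ring

/-- Polynomials times a Gaussian are total in the weighted Bergman space. -/
theorem eq_zero_of_forall_integral_eq_zero (hH : IsPosHerm H) {k : ℝ} (hk : k < 1)
    (hk0 : 0 ≤ k) (hR : ∀ z, ‖z ⬝ᵥ R *ᵥ z‖ ≤ k * hermForm H z)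
    {f : (Fin n → ℂ) → ℂ} (hf : Differentiable ℂ f)
    (hf2 : MemLp (fun z => f z * gauss H z) 2 volume)
    (h0 : ∀ p : MvPolynomial (Fin n) ℂ,
      ∫ z, starRingEnd ℂ (MvPolynomial.eval z p * Complex.exp (-(z ⬝ᵥ R *ᵥ z))) * f z
        * gauss H z ^ 2 = 0) : f = 0 := by
  funext a
  obtain ⟨hHh, c, hc, hcH⟩ := id hH
  set D := ∑ i, ∑ j, ‖H i j‖ with hD
  have hD0 : 0 ≤ D := by positivity
  -- Any r with 1 < r and rk < 1 would do: the first puts 0 in the ball around 1, the second keeps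
  -- the integrals below convergent on that ball.
  set r : ℝ := 2 / (1 + k) with hr
  have hr1 : 1 < r := by rw [hr, lt_div_iff₀ (by positivity)]; linarith
  have hrk : r * k < 1 := by
    rw [hr, div_mul_eq_mul_div, div_lt_one (by positivity)]; linarith
  -- With q the conjugate of b, the exponent tq - conj⟨z, Rz⟩ joins the conjugate Gaussian at t = 0
  -- to the kernel exponent 2⟨a, H z̄⟩ at t = 1.
  set b : MvPolynomial (Fin n) ℂ :=
    quadPoly R + MvPolynomial.C 2 * ∑ i, MvPolynomial.C ((H *ᵥ star a) i) * MvPolynomial.X i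
    with hb
  have hbe : ∀ z, MvPolynomial.eval z b = z ⬝ᵥ R *ᵥ z + 2 * sesq H z a := by
    intro z
    simp [hb, eval_quadPoly, sesq, dotProduct, mul_comm]
  set q : (Fin n → ℂ) → ℂ := fun z => starRingEnd ℂ (MvPolynomial.eval z b) with hq
  have hqs : SubGaussian q := (SubGaussian.mvPolynomial b).star
  have hqe : ∀ z, q z = starRingEnd ℂ (z ⬝ᵥ R *ᵥ z) + 2 * sesq H a z := by
    intro z
    rw [hq]
    simp only [hbe, map_add, map_mul, conj_sesq hHh, Complex.conj_ofNat]
  have hRs : Continuous fun z : Fin n → ℂ => z ⬝ᵥ R *ᵥ z := by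
    simp only [← eval_quadPoly]
    exact (SubGaussian.mvPolynomial _).1
  set e : ℂ → (Fin n → ℂ) → ℂ := fun t z =>
    Complex.exp (t * q z - starRingEnd ℂ (z ⬝ᵥ R *ᵥ z)) * gauss H z with he
  have hec : ∀ t, Continuous (e t) := by
    intro t
    have := hqs.1
    have := Complex.continuous_conj.comp hRs
    simp only [Function.comp_def] at this
    simp only [he]
    fun_prop
  obtain ⟨C, δ, hδ, hbound⟩ : ∃ C δ : ℝ, 0 < δ ∧ ∀ t ∈ Metric.ball (1 : ℂ) r, ∀ z,
      ‖e t z‖ ≤ C * Real.exp (-δ * sqNorm z) := by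
    -- Of the decay (1 - rk)c left over by the quadratic terms, half absorbs the linear term D'‖z‖
    -- and half remains.
    set δ := (1 - r * k) * c / 2 with hδ
    have hδ0 : 0 < δ := by
      have : 0 < 1 - r * k := by linarith
      positivity
    set D' := 2 * (r + 1) * (D * ‖a‖) with hD'
    refine ⟨Real.exp (D' ^ 2 / (4 * δ)), δ, hδ0, fun t ht z => ?_⟩
    rw [Metric.mem_ball, dist_eq_norm] at ht
    rw [he, norm_mul, norm_gauss, Complex.norm_exp, ← Real.exp_add, ← Real.exp_add]
    refine Real.exp_le_exp.2 ?_
    -- Centring at t = 1 shows that the quadratic part has size at most |t - 1| k⟨z, H z̄⟩, which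
    -- explains the choice of ball.
    have h1 : t * q z - starRingEnd ℂ (z ⬝ᵥ R *ᵥ z)
        = (t - 1) * starRingEnd ℂ (z ⬝ᵥ R *ᵥ z) + t * (2 * sesq H a z) := by
      rw [hqe]
      ring
    have hh : 0 ≤ hermForm H z :=
      (mul_nonneg hc.le (sqNorm_nonneg z)).trans (hcH z)
    have h2 : ‖(t - 1) * starRingEnd ℂ (z ⬝ᵥ R *ᵥ z)‖ ≤ r * (k * hermForm H z) := by
      rw [norm_mul, RCLike.norm_conj]
      exact mul_le_mul ht.le (hR z) (norm_nonneg _) (by positivity)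
    have ht' : ‖t‖ ≤ r + 1 := by
      have := norm_le_insert' t 1
      rw [norm_one] at this
      linarith
    have h3 : ‖t * (2 * sesq H a z)‖ ≤ D' * ‖z‖ := by
      rw [norm_mul, norm_mul, Complex.norm_ofNat]
      calc ‖t‖ * (2 * ‖sesq H a z‖) ≤ (r + 1) * (2 * (D * ‖a‖ * ‖z‖)) := by
            gcongr
            exact norm_sesq_le H a z
        _ = D' * ‖z‖ := by rw [hD']; ring
    have h4 : (t * q z - starRingEnd ℂ (z ⬝ᵥ R *ᵥ z)).re
        ≤ r * (k * hermForm H z) + D' * ‖z‖ := by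
      refine (Complex.re_le_norm _).trans ?_
      rw [h1]
      exact (norm_add_le _ _).trans (add_le_add h2 h3)
    have h5 : (1 - r * k) * (c * sqNorm z) ≤ (1 - r * k) * hermForm H z :=
      mul_le_mul_of_nonneg_left (hcH z) (by linarith)
    have h6 := mul_norm_le_sqNorm D' hδ0 z
    have h7 : (1 - r * k) * (c * sqNorm z) = 2 * δ * sqNorm z := by rw [hδ]; ring
    linarith
  have hmem : ∀ (m : ℕ), ∀ t ∈ Metric.ball (1 : ℂ) r,
      Integrable fun z => f z * gauss H z * (q z ^ m * e t z) := by
    intro m t ht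
    have hqm : SubGaussian fun z => q z ^ m := by
      induction m with
      | zero => simpa using SubGaussian.const 1
      | succ m ih => simpa only [pow_succ] using ih.mul hqs
    exact hf2.integrable_mul (hqm.memLp_mul (hec t) hδ (hbound t ht))
  set g : ℕ → ℂ → ℂ := fun m t => ∫ z, f z * gauss H z * (q z ^ m * e t z) with hg
  have hderiv : ∀ m, ∀ t ∈ Metric.ball (1 : ℂ) r, HasDerivAt (g m) (g (m + 1) t) t := by
    intro m t ht
    have hqm : SubGaussian fun z => q z ^ (m + 1) := by
      induction m with
      | zero => simpa using hqs
      | succ m ih => simpa only [pow_succ] using ih.mul hqs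
    have hgb : MemLp (fun z => q z ^ (m + 1) * ((C * Real.exp (-δ * sqNorm z) : ℝ) : ℂ)) 2
        volume := by
      refine hqm.memLp_mul (C := |C|) (by fun_prop) hδ fun z => ?_
      rw [Complex.norm_real, norm_mul, Real.norm_eq_abs, Real.norm_of_nonneg (Real.exp_pos _).le]
    refine (hasDerivAt_integral_of_dominated_loc_of_deriv_le
      (F := fun t z => f z * gauss H z * (q z ^ m * e t z))
      (F' := fun t z => f z * gauss H z * (q z ^ (m + 1) * e t z))
      (Metric.isOpen_ball.mem_nhds ht) ?_ (hmem m t ht)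
      (hmem (m + 1) t ht).aestronglyMeasurable (Filter.Eventually.of_forall fun z s hs => ?_)
      (hf2.integrable_mul hgb).norm (Filter.Eventually.of_forall fun z s _ => ?_)).2
    · filter_upwards [Metric.isOpen_ball.mem_nhds ht] with s hs
      exact (hmem m s hs).aestronglyMeasurable
    · simp only [Pi.mul_apply, norm_mul, Complex.norm_real]
      gcongr
      rw [← norm_mul, Real.norm_eq_abs]
      exact (hbound s hs z).trans (le_abs_self _)
    · have h1 : HasDerivAt (fun s : ℂ => s * q z - starRingEnd ℂ (z ⬝ᵥ R *ᵥ z)) (q z) s := by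
        simpa using ((hasDerivAt_id s).mul_const (q z)).sub_const (starRingEnd ℂ (z ⬝ᵥ R *ᵥ z))
      have h2 := (((h1.cexp.mul_const (gauss H z)).const_mul (q z ^ m))).const_mul
        (f z * gauss H z)
      refine h2.congr_deriv ?_
      simp only [he]
      ring
  have h1 : (1 : ℂ) ∈ Metric.ball (1 : ℂ) r := Metric.mem_ball_self (by linarith)
  have hzero : (0 : ℂ) ∈ Metric.ball (1 : ℂ) r := by simpa using hr1
  -- The m-th derivative at 0 pairs f with bᵐ times the Gaussian, so the orthogonality hypothesis
  -- applies.
  have hg0 : ∀ m, g m 0 = 0 := by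
    intro m
    refine Eq.trans ?_ (h0 (b ^ m))
    refine integral_congr_ae (Filter.Eventually.of_forall fun z => ?_)
    simp only [he, map_mul, map_pow, ← Complex.exp_conj, map_neg, zero_mul, zero_sub, hq]
    ring
  have hfin := eq_zero_of_hasDerivAt_of_eq_zero hderiv hzero hg0 h1
  have hrep : g 0 1 = f a * ∫ z, gauss H z ^ 2 := by
    rw [← integral_exp_sesq hH hf hf2 a]
    refine integral_congr_ae (Filter.Eventually.of_forall fun z => ?_)
    simp only [he, hqe, pow_zero, one_mul, add_sub_cancel_left]
    ring
  rw [hrep] at hfin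
  exact (mul_eq_zero.1 hfin).resolve_right (integral_gauss_sq_ne_zero hH)

end Density

/-! ### Integration by parts for ∂/∂zᵢ. -/

section IntegrationByParts

variable {n : ℕ} {H R : Matrix (Fin n) (Fin n) ℂ}

theorem hasFDerivAt_mvPolynomial_eval (p : MvPolynomial (Fin n) ℂ) (z : Fin n → ℂ) :
    HasFDerivAt (fun z => MvPolynomial.eval z p)
      (∑ k, MvPolynomial.eval z (MvPolynomial.pderiv k p) •
        (ContinuousLinearMap.proj k : (Fin n → ℂ) →L[ℂ] ℂ)) z := by
  induction p using MvPolynomial.induction_on with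
  | C a =>
    simp only [MvPolynomial.eval_C]
    refine (hasFDerivAt_const (𝕜 := ℂ) a z).congr_fderiv ?_
    refine ContinuousLinearMap.ext fun v => ?_
    simp
  | add p q hp hq =>
    simp only [map_add]
    refine (hp.add hq).congr_fderiv ?_
    refine ContinuousLinearMap.ext fun v => ?_
    simp [add_mul, Finset.sum_add_distrib]
  | mul_X p i hp =>
    simp only [map_mul, MvPolynomial.eval_X]
    refine (hp.mul (hasFDerivAt_apply i z)).congr_fderiv ?_
    refine ContinuousLinearMap.ext fun v => ?_
    simp [MvPolynomial.pderiv_X, Pi.single_apply, add_mul, Finset.sum_add_distrib, Finset.mul_sum,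
      mul_assoc, apply_ite, ite_mul]

theorem differentiable_mvPolynomial_eval (p : MvPolynomial (Fin n) ℂ) :
    Differentiable ℂ fun z => MvPolynomial.eval z p := fun z =>
  (hasFDerivAt_mvPolynomial_eval p z).differentiableAt

theorem fderiv_mvPolynomial_eval_single (p : MvPolynomial (Fin n) ℂ) (z : Fin n → ℂ) (i : Fin n) :
    fderiv ℂ (fun z => MvPolynomial.eval z p) z (Pi.single i 1)
      = MvPolynomial.eval z (MvPolynomial.pderiv i p) := by
  rw [(hasFDerivAt_mvPolynomial_eval p z).fderiv]
  simp [Pi.single_apply]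

theorem differentiable_dotProduct_mulVec (M : Matrix (Fin n) (Fin n) ℂ) :
    Differentiable ℂ fun z : Fin n → ℂ => z ⬝ᵥ M *ᵥ z := by
  simp only [← eval_quadPoly]
  exact differentiable_mvPolynomial_eval _

theorem fderiv_dotProduct_mulVec_single {M : Matrix (Fin n) (Fin n) ℂ} (hM : Mᵀ = M)
    (z : Fin n → ℂ) (i : Fin n) :
    fderiv ℂ (fun z : Fin n → ℂ => z ⬝ᵥ M *ᵥ z) z (Pi.single i 1) = 2 * (M *ᵥ z) i := by
  set e : Fin n → ℂ := Pi.single i 1 with he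
  have h1 : z ⬝ᵥ M *ᵥ e = (M *ᵥ z) i := by
    rw [Matrix.dotProduct_mulVec, ← Matrix.mulVec_transpose, hM]
    simp [he]
  have h2 : e ⬝ᵥ M *ᵥ z = (M *ᵥ z) i := by simp [he]
  rw [← ((differentiable_dotProduct_mulVec M) z).lineDeriv_eq_fderiv]
  refine HasDerivAt.deriv ?_
  have h3 : ∀ t : ℂ, (z + t • e) ⬝ᵥ M *ᵥ (z + t • e)
      = z ⬝ᵥ M *ᵥ z + t * (2 * (M *ᵥ z) i) + t ^ 2 * (e ⬝ᵥ M *ᵥ e) := by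
    intro t
    simp only [Matrix.mulVec_add, Matrix.mulVec_smul, add_dotProduct, dotProduct_add,
      smul_dotProduct, dotProduct_smul, smul_eq_mul, h1, h2]
    ring
  simp only [h3]
  have h0 := hasDerivAt_id (0 : ℂ)
  refine (((h0.mul_const (2 * (M *ᵥ z) i)).const_add (z ⬝ᵥ M *ᵥ z)).add
    ((h0.pow 2).mul_const (e ⬝ᵥ M *ᵥ e))).congr_deriv ?_
  simp

theorem hasLineDerivAt_conj_mul_gauss_sq (hH : H.IsHermitian) {g : (Fin n → ℂ) → ℂ}
    (hg : Differentiable ℂ g) (z v : Fin n → ℂ) :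
    HasLineDerivAt ℝ (fun z => starRingEnd ℂ (g z) * gauss H z ^ 2)
      (starRingEnd ℂ (fderiv ℂ g z v) * gauss H z ^ 2
        - 2 * (sesq H v z + sesq H z v) * (starRingEnd ℂ (g z) * gauss H z ^ 2)) z v := by
  have h1 : HasDerivAt (fun t : ℝ => g (z + t • v)) (fderiv ℂ g z v) 0 :=
    ((hg z).hasFDerivAt.restrictScalars ℝ).hasLineDerivAt v
  have h2 : HasDerivAt (fun t : ℝ => starRingEnd ℂ (g (z + t • v)))
      (starRingEnd ℂ (fderiv ℂ g z v)) 0 := h1.star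
  have h3 : ∀ t : ℝ, sesq H (z + t • v) (z + t • v)
      = sesq H z z + t * (sesq H v z + sesq H z v) + (t : ℂ) ^ 2 * sesq H v v := by
    intro t
    have e1 : ∀ w, sesq H (t • v) w = t * sesq H v w := by
      intro w
      simp [sesq]
    have e2 : ∀ w, sesq H w (t • v) = t * sesq H w v := by
      intro w
      simp [sesq, star_smul, Matrix.mulVec_smul]
    simp only [sesq_add_left, sesq_add_right, e1, e2]
    ring
  have h0 : HasDerivAt (fun t : ℝ => (t : ℂ)) 1 0 := by
    simpa using (hasDerivAt_id (0 : ℝ)).ofReal_comp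
  have h4 : HasDerivAt (fun t : ℝ => sesq H (z + t • v) (z + t • v))
      (sesq H v z + sesq H z v) 0 := by
    simp only [h3]
    refine (((h0.mul_const (sesq H v z + sesq H z v)).const_add (sesq H z z)).add
      ((h0.pow 2).mul_const (sesq H v v))).congr_deriv ?_
    simp
  have h5 := h2.mul (h4.const_mul (-2)).cexp
  simp only [zero_smul, add_zero] at h5
  simp only [HasLineDerivAt, gauss_sq hH]
  refine h5.congr_deriv ?_
  ring

/-- Since conj g is antiholomorphic, ∂/∂zᵢ of conj(g) exp(-2⟨z, H z̄⟩) falls on the weight alone.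
The formula is assembled from real integrations by parts in the directions e and ie, through ∂ =
(∂_e - i ∂_ie)/2. -/
theorem integral_mul_conj_of_integrable (hH : H.IsHermitian) {f g : (Fin n → ℂ) → ℂ}
    (hf : Differentiable ℂ f) (hg : Differentiable ℂ g) (i : Fin n)
    (h1 : Integrable fun z => fderiv ℂ f z (Pi.single i 1) *
      (starRingEnd ℂ (g z) * gauss H z ^ 2))
    (h2 : Integrable fun z => f z * (starRingEnd ℂ (fderiv ℂ g z (Pi.single i 1)) * gauss H z ^ 2))
    (h3 : Integrable fun z => f z * (starRingEnd ℂ (g z) * gauss H z ^ 2))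
    (h4 : Integrable fun z => (H *ᵥ star z) i * (f z * (starRingEnd ℂ (g z) * gauss H z ^ 2)))
    (h5 : Integrable fun z => starRingEnd ℂ ((H *ᵥ star z) i) *
      (f z * (starRingEnd ℂ (g z) * gauss H z ^ 2))) :
    ∫ z, fderiv ℂ f z (Pi.single i 1) * (starRingEnd ℂ (g z) * gauss H z ^ 2)
      = ∫ z, 2 * (H *ᵥ star z) i * (f z * (starRingEnd ℂ (g z) * gauss H z ^ 2)) := by
  set e : Fin n → ℂ := Pi.single i 1 with he
  set W : (Fin n → ℂ) → ℂ := fun z => starRingEnd ℂ (g z) * gauss H z ^ 2 with hW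
  have hb : ∀ z, sesq H e z = (H *ᵥ star z) i := fun z => by simp [sesq, he]
  have hIl : ∀ z, sesq H (Complex.I • e) z = Complex.I * (H *ᵥ star z) i := by
    intro z
    rw [← hb]
    simp [sesq]
  have hd : ∀ v z, HasLineDerivAt ℝ f (fderiv ℂ f z v) z v := fun v z =>
    ((hf z).hasFDerivAt.restrictScalars ℝ).hasLineDerivAt v
  have k1 : ∀ z, f z * (starRingEnd ℂ (fderiv ℂ g z e) * gauss H z ^ 2
        - 2 * (sesq H e z + sesq H z e) * (starRingEnd ℂ (g z) * gauss H z ^ 2))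
      = f z * (starRingEnd ℂ (fderiv ℂ g z e) * gauss H z ^ 2)
        - 2 * ((H *ᵥ star z) i * (f z * W z)
          + starRingEnd ℂ ((H *ᵥ star z) i) * (f z * W z)) := by
    intro z
    rw [← conj_sesq hH e z, hb]
    ring
  have k2 : ∀ z, f z * (starRingEnd ℂ (fderiv ℂ g z (Complex.I • e)) * gauss H z ^ 2
        - 2 * (sesq H (Complex.I • e) z + sesq H z (Complex.I • e))
          * (starRingEnd ℂ (g z) * gauss H z ^ 2))
      = -Complex.I * (f z * (starRingEnd ℂ (fderiv ℂ g z e) * gauss H z ^ 2))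
        - 2 * (Complex.I * ((H *ᵥ star z) i * (f z * W z))
          - Complex.I * (starRingEnd ℂ ((H *ᵥ star z) i) * (f z * W z))) := by
    intro z
    rw [← conj_sesq hH (Complex.I • e) z, hIl]
    simp only [map_smul, smul_eq_mul, map_mul, Complex.conj_I, hW]
    ring
  have i1 : Integrable fun z => f z * (starRingEnd ℂ (fderiv ℂ g z e) * gauss H z ^ 2
        - 2 * (sesq H e z + sesq H z e) * (starRingEnd ℂ (g z) * gauss H z ^ 2)) := by
    simp only [k1]
    exact h2.sub ((h4.add h5).const_mul 2)
  have i2 : Integrable fun z =>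
      f z * (starRingEnd ℂ (fderiv ℂ g z (Complex.I • e)) * gauss H z ^ 2
        - 2 * (sesq H (Complex.I • e) z + sesq H z (Complex.I • e))
          * (starRingEnd ℂ (g z) * gauss H z ^ 2)) := by
    simp only [k2]
    exact (h2.const_mul _).sub (((h4.const_mul _).sub (h5.const_mul _)).const_mul 2)
  have j2 : Integrable fun z => fderiv ℂ f z (Complex.I • e) * W z := by
    simp only [map_smul, smul_eq_mul, mul_assoc]
    exact h1.const_mul _
  have b1 := integral_bilinear_hasLineDerivAt_right_eq_neg_left_of_integrable
    (B := ContinuousLinearMap.mul ℝ ℂ) (μ := volume) (v := e) h1 i1 h3 (fun z _ => hd _ z)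
    (fun z _ => hasLineDerivAt_conj_mul_gauss_sq hH hg z e)
  have b2 := integral_bilinear_hasLineDerivAt_right_eq_neg_left_of_integrable
    (B := ContinuousLinearMap.mul ℝ ℂ) (μ := volume) (v := Complex.I • e) j2 i2 h3
    (fun z _ => hd _ z)
    (fun z _ => hasLineDerivAt_conj_mul_gauss_sq hH hg z (Complex.I • e))
  simp only [ContinuousLinearMap.mul_apply'] at b1 b2
  have c2 : ∫ z, fderiv ℂ f z (Complex.I • e) * W z
      = Complex.I * ∫ z, fderiv ℂ f z e * W z := by
    rw [← integral_const_mul]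
    simp only [map_smul, smul_eq_mul, mul_assoc]
  -- In the combination ∂_e - i ∂_ie both the derivative of conj g and the conjugate coefficient
  -- conj((H z̄)ᵢ) cancel.
  have c3 : (∫ z, f z * (starRingEnd ℂ (fderiv ℂ g z e) * gauss H z ^ 2
        - 2 * (sesq H e z + sesq H z e) * (starRingEnd ℂ (g z) * gauss H z ^ 2)))
      - Complex.I * (∫ z, f z * (starRingEnd ℂ (fderiv ℂ g z (Complex.I • e)) * gauss H z ^ 2
        - 2 * (sesq H (Complex.I • e) z + sesq H z (Complex.I • e))
          * (starRingEnd ℂ (g z) * gauss H z ^ 2)))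
      = -2 * ∫ z, 2 * (H *ᵥ star z) i * (f z * W z) := by
    rw [← integral_const_mul, ← integral_sub i1 (i2.const_mul _), ← integral_const_mul]
    refine integral_congr_ae (Filter.Eventually.of_forall fun z => ?_)
    simp only [k1, k2]
    linear_combination (f z * (starRingEnd ℂ (fderiv ℂ g z e) * gauss H z ^ 2)
      + 2 * ((H *ᵥ star z) i * (f z * W z)) - 2 * (starRingEnd ℂ ((H *ᵥ star z) i) * (f z * W z)))
      * Complex.I_mul_I
  rw [b1, b2, c2] at c3
  linear_combination (-1 / 2 : ℂ) * c3 + (1 / 2 : ℂ) * (∫ z, fderiv ℂ f z e * W z)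
    * Complex.I_mul_I

end IntegrationByParts

/-! ### Polynomials times exp(-⟨z, Rz⟩). -/

section PolyGauss

variable {n : ℕ}

/-- The symmetric matrix `R` is a strict contraction relative to `H`. -/
structure GaussianPair (H R : Matrix (Fin n) (Fin n) ℂ) : Prop where
  posHerm : IsPosHerm H
  symm : Rᵀ = R
  contraction : ∃ k : ℝ, 0 ≤ k ∧ k < 1 ∧ ∀ z, ‖z ⬝ᵥ R *ᵥ z‖ ≤ k * hermForm H z

/-- A polynomial times the Gaussian `exp(-⟨z,Rz⟩)`. -/
def polyGauss (R : Matrix (Fin n) (Fin n) ℂ) (p : MvPolynomial (Fin n) ℂ) (z : Fin n → ℂ) : ℂ :=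
  MvPolynomial.eval z p * Complex.exp (-(z ⬝ᵥ R *ᵥ z))

variable {H R : Matrix (Fin n) (Fin n) ℂ}

theorem differentiable_polyGauss (p : MvPolynomial (Fin n) ℂ) :
    Differentiable ℂ (polyGauss R p) :=
  (differentiable_mvPolynomial_eval p).mul (differentiable_dotProduct_mulVec R).neg.cexp

theorem SubGaussian.memLp_mul_polyGauss (h : GaussianPair H R) {u : (Fin n → ℂ) → ℂ}
    (hu : SubGaussian u) (p : MvPolynomial (Fin n) ℂ) :
    MemLp (fun z => u z * polyGauss R p z * gauss H z) 2 volume := by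
  obtain ⟨k, -, hk1, hk⟩ := h.contraction
  obtain ⟨-, c, hc, hcH⟩ := h.posHerm
  have hc' : 0 < (1 - k) * c := mul_pos (by linarith) hc
  have hcont : Continuous fun z => Complex.exp (-(z ⬝ᵥ R *ᵥ z)) :=
    (differentiable_dotProduct_mulVec R).neg.cexp.continuous
  have := (hu.mul (SubGaussian.mvPolynomial p)).memLp_mul
    (g := fun z => Complex.exp (-(z ⬝ᵥ R *ᵥ z)) * gauss H z) (by fun_prop) (C := 1) hc' fun z => ?_
  · simpa only [polyGauss, mul_assoc] using this
  · rw [norm_mul, norm_gauss, one_mul, Complex.norm_exp, ← Real.exp_add]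
    refine Real.exp_le_exp.2 ?_
    have h1 : (-(z ⬝ᵥ R *ᵥ z)).re ≤ k * hermForm H z :=
      (Complex.re_le_norm _).trans (by rw [norm_neg]; exact hk z)
    have h2 : (1 - k) * (c * sqNorm z) ≤ (1 - k) * hermForm H z :=
      mul_le_mul_of_nonneg_left (hcH z) (by linarith)
    linarith

theorem memLp_polyGauss (h : GaussianPair H R) (p : MvPolynomial (Fin n) ℂ) :
    MemLp (fun z => polyGauss R p z * gauss H z) 2 volume := by
  simpa using (SubGaussian.const 1).memLp_mul_polyGauss h p

theorem polyGauss_fderiv (hR : Rᵀ = R) (p : MvPolynomial (Fin n) ℂ) (z : Fin n → ℂ) (i : Fin n) :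
    fderiv ℂ (polyGauss R p) z (Pi.single i 1)
      = polyGauss R (MvPolynomial.pderiv i p) z - 2 * (R *ᵥ z) i * polyGauss R p z := by
  have h1 := (differentiable_mvPolynomial_eval p z).hasFDerivAt
  have h2 := (differentiable_dotProduct_mulVec R z).hasFDerivAt.neg.cexp
  have h3 : HasFDerivAt (polyGauss R p) _ z := h1.mul h2
  simp only [Pi.neg_apply] at h3
  rw [h3.fderiv]
  simp only [add_apply, smul_apply, smul_eq_mul, neg_apply, fderiv_mvPolynomial_eval_single,
    fderiv_dotProduct_mulVec_single hR, polyGauss]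
  ring

theorem memLp_conj_mul_gauss {g : (Fin n → ℂ) → ℂ}
    (hg : MemLp (fun z => g z * gauss H z) 2 volume) :
    MemLp (fun z => starRingEnd ℂ (g z) * gauss H z) 2 volume := by
  refine hg.star.ae_eq (Filter.Eventually.of_forall fun z => ?_)
  change starRingEnd ℂ (g z * gauss H z) = _
  rw [map_mul, conj_gauss]

/-- Integration by parts moving `∂/∂zᵢ + 2(Rz)ᵢ` onto a polynomial times a Gaussian. -/
theorem integral_conj_polyGauss_mul (h : GaussianPair H R) {f : (Fin n → ℂ) → ℂ}
    (hf : Differentiable ℂ f) (hf2 : MemLp (fun z => f z * gauss H z) 2 volume) (i : Fin n)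
    (hd2 : MemLp (fun z => (fderiv ℂ f z (Pi.single i 1) + 2 * (R *ᵥ z) i * f z) * gauss H z) 2
      volume) (p : MvPolynomial (Fin n) ℂ) :
    ∫ z, starRingEnd ℂ (polyGauss R p z) * (fderiv ℂ f z (Pi.single i 1) + 2 * (R *ᵥ z) i * f z)
        * gauss H z ^ 2
      = ∫ z, starRingEnd ℂ (polyGauss R p z) * (2 * ((H *ᵥ star z) i + (R *ᵥ z) i) * f z)
        * gauss H z ^ 2 := by
  have hG := memLp_conj_mul_gauss (memLp_polyGauss h p)
  have hu : ∀ u, SubGaussian u →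
      Integrable fun z => u z * f z * starRingEnd ℂ (polyGauss R p z) * gauss H z ^ 2 := by
    intro u hu
    refine (integrable_mul_gauss_sq hf2
      (memLp_conj_mul_gauss (hu.star.memLp_mul_polyGauss h p))).congr
      (Filter.Eventually.of_forall fun z => ?_)
    simp only [map_mul, Complex.conj_conj]
    ring
  have hRi := hu _ ((SubGaussian.const 2).mul (SubGaussian.mulVec R i))
  have hHi := hu _ (SubGaussian.mulVec_star H i)
  have hD := integrable_mul_gauss_sq hd2 hG
  -- Only the sum ∂ᵢf + 2(Rz)ᵢf is assumed square-integrable; the derivative by itself becomes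
  -- integrable once paired with the decaying factor.
  have hdp : Integrable fun z => fderiv ℂ f z (Pi.single i 1) *
      (starRingEnd ℂ (polyGauss R p z) * gauss H z ^ 2) := by
    refine (hD.sub hRi).congr (Filter.Eventually.of_forall fun z => ?_)
    simp only [Pi.sub_apply]
    ring
  have key := integral_mul_conj_of_integrable h.posHerm.1 hf (differentiable_polyGauss p) i hdp
    ?_ ?_ ?_ ?_
  · have e1 : ∀ z, starRingEnd ℂ (polyGauss R p z) *
        (fderiv ℂ f z (Pi.single i 1) + 2 * (R *ᵥ z) i * f z) * gauss H z ^ 2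
        = fderiv ℂ f z (Pi.single i 1) * (starRingEnd ℂ (polyGauss R p z) * gauss H z ^ 2)
          + 2 * (R *ᵥ z) i * f z * starRingEnd ℂ (polyGauss R p z) * gauss H z ^ 2 := fun z => by
      ring
    have e2 : ∀ z, starRingEnd ℂ (polyGauss R p z) *
        (2 * ((H *ᵥ star z) i + (R *ᵥ z) i) * f z) * gauss H z ^ 2
        = 2 * (H *ᵥ star z) i * (f z * (starRingEnd ℂ (polyGauss R p z) * gauss H z ^ 2))
          + 2 * (R *ᵥ z) i * f z * starRingEnd ℂ (polyGauss R p z) * gauss H z ^ 2 := fun z => by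
      ring
    simp only [e1, e2]
    rw [integral_add hdp hRi, integral_add ?_ hRi, key]
    refine (hHi.const_mul 2).congr (Filter.Eventually.of_forall fun z => ?_)
    ring
  · simp only [polyGauss_fderiv h.symm]
    have h1 := integrable_mul_gauss_sq hf2
      (memLp_conj_mul_gauss (memLp_polyGauss h (MvPolynomial.pderiv i p)))
    have h2 := hu _ ((SubGaussian.const 2).mul (SubGaussian.mulVec R i)).star
    refine (h1.sub h2).congr (Filter.Eventually.of_forall fun z => ?_)
    simp only [Pi.sub_apply, map_sub, map_mul]
    ring
  · refine (hu _ (SubGaussian.const 1)).congr (Filter.Eventually.of_forall fun z => ?_)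
    ring
  · refine hHi.congr (Filter.Eventually.of_forall fun z => ?_)
    ring
  · refine (hu _ (SubGaussian.mulVec_star H i).star).congr (Filter.Eventually.of_forall fun z => ?_)
    ring

end PolyGauss

/-! ### Commutation relations of the ladder operators on polynomials. -/

section CreationPoly

open MvPolynomial

variable {n : ℕ} (κ : ℂ) (T : Matrix (Fin n) (Fin n) ℂ)

/-- The creation operator `κ zᵢ + ∑ₖ Tᵢₖ ∂/∂zₖ` on polynomials. -/
def creationPoly (i : Fin n) : MvPolynomial (Fin n) ℂ →ₗ[ℂ] MvPolynomial (Fin n) ℂ :=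
  κ • LinearMap.mulLeft ℂ (X i) + ∑ k, T i k • (pderiv (R := ℂ) k).toLinearMap

theorem creationPoly_apply (i : Fin n) (p : MvPolynomial (Fin n) ℂ) :
    creationPoly κ T i p = κ • (X i * p) + ∑ k, T i k • pderiv k p := by
  simp [creationPoly]

theorem pderiv_comm (i j : Fin n) (p : MvPolynomial (Fin n) ℂ) :
    pderiv i (pderiv j p) = pderiv j (pderiv i p) := by
  have h : ⁅pderiv (R := ℂ) i, pderiv (R := ℂ) j⁆ = 0 := by
    refine MvPolynomial.derivation_ext fun k => ?_
    rw [Derivation.commutator_apply]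
    simp only [pderiv_X, Pi.single_apply]
    split_ifs <;> simp
  have := congrArg (fun D => D p) h
  simp only [Derivation.commutator_apply, Derivation.zero_apply] at this
  exact sub_eq_zero.1 this

/-- The canonical commutation relation [∂ᵢ, cⱼ] = κ δᵢⱼ; the terms in T drop out because partial
derivatives commute. -/
theorem pderiv_creationPoly (i j : Fin n) (p : MvPolynomial (Fin n) ℂ) :
    pderiv i (creationPoly κ T j p)
      = creationPoly κ T j (pderiv i p) + (if i = j then κ else 0) • p := by
  simp only [creationPoly_apply, map_add, map_sum, Derivation.map_smul, Derivation.leibniz,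
    pderiv_X, smul_eq_mul, pderiv_comm i]
  by_cases h : i = j
  · subst h
    simp [smul_add]
    abel
  · simp [h, Ne.symm h]

variable {T}

theorem creationPoly_X_mul (i j : Fin n) (p : MvPolynomial (Fin n) ℂ) :
    creationPoly κ T j (X i * p) = X i * creationPoly κ T j p + T j i • p := by
  have h : ∑ k, T j k • (p * pderiv k (X i)) = T j i • p := by
    rw [Finset.sum_eq_single i]
    · simp
    · intro b _ hb
      simp [pderiv_X_of_ne hb.symm]
    · simp
  simp only [creationPoly_apply, Derivation.leibniz, smul_eq_mul, smul_add, mul_add,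
    Finset.sum_add_distrib, Finset.mul_sum, mul_smul_comm, mul_left_comm (X j) (X i), h]
  rw [add_assoc]

/-- The cross terms contribute κ(Tᵢⱼ - Tⱼᵢ) to the commutator, which is why T must be symmetric. -/
theorem creationPoly_comm (hT : Tᵀ = T) (i j : Fin n) (p : MvPolynomial (Fin n) ℂ) :
    creationPoly κ T i (creationPoly κ T j p) = creationPoly κ T j (creationPoly κ T i p) := by
  have hTs : T i j = T j i := congrFun (congrFun hT j) i
  rw [creationPoly_apply κ T i, creationPoly_apply κ T i p]
  simp only [pderiv_creationPoly, map_add, map_sum, map_smul, creationPoly_X_mul, smul_add,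
    Finset.sum_add_distrib]
  rw [Finset.sum_eq_single (a := j) (f := fun k => T i k • (if k = j then κ else 0) • p)]
  · rw [if_pos rfl, hTs, smul_comm]
    abel
  · intro b _ hb
    simp [hb]
  · simp

end CreationPoly

/-! ### Matrix identities that follow from the choice of Q. -/

section MatrixAlgebra

variable {n : ℕ}

theorem ofReal_sqNorm (z : Fin n → ℂ) : ((sqNorm z : ℝ) : ℂ) = z ⬝ᵥ star z := by
  simp only [sqNorm, dotProduct, Complex.ofReal_sum, Pi.star_apply]
  refine Finset.sum_congr rfl fun i _ => ?_
  rw [Complex.star_def, Complex.mul_conj, Complex.normSq_eq_norm_sq]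

theorem sqNorm_mulVec {V : Matrix (Fin n) (Fin n) ℂ} (hV : Vᴴ * V = 1) (z : Fin n → ℂ) :
    sqNorm (V *ᵥ z) = sqNorm z := by
  rw [← Complex.ofReal_inj, ofReal_sqNorm, ofReal_sqNorm, dotProduct_comm, Matrix.star_mulVec,
    ← Matrix.dotProduct_mulVec, Matrix.mulVec_mulVec, hV, Matrix.one_mulVec, dotProduct_comm]

theorem mulVec_dotProduct (M : Matrix (Fin n) (Fin n) ℂ) (z y : Fin n → ℂ) :
    (M *ᵥ z) ⬝ᵥ y = z ⬝ᵥ Mᵀ *ᵥ y := by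
  rw [Matrix.dotProduct_mulVec, Matrix.vecMul_transpose]

theorem star_mulVec_eq (M : Matrix (Fin n) (Fin n) ℂ) (z : Fin n → ℂ) :
    star (M *ᵥ z) = (Mᴴ)ᵀ *ᵥ star z := by
  rw [Matrix.star_mulVec, Matrix.mulVec_transpose]

/-- The matrix identities behind the canonical commutation relations. -/
theorem gaussianPair_of_diagonalization (hn : 0 < n) {H U X : Matrix (Fin n) (Fin n) ℂ}
    {lam : Fin n → ℝ} {ρ : ℝ} (hU : U ∈ Matrix.unitaryGroup (Fin n) ℂ)
    (hlam : ∀ i, 0 < lam i) (hdiag : Uᴴ * H * U = Matrix.diagonal fun i => ((lam i : ℂ)) ^ 2)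
    (hρ : 0 < ρ) (hρlam : ∀ i, ρ < lam i) (hX : X ∈ Matrix.unitaryGroup (Fin n) ℂ)
    (hXsymm : Xᵀ * Matrix.diagonal (fun i => ((BargmannPhase.mu ρ lam i / lam i : ℝ) : ℂ)) =
      Matrix.diagonal (fun i => ((BargmannPhase.mu ρ lam i / lam i : ℝ) : ℂ)) * X)
    {R : Matrix (Fin n) (Fin n) ℂ}
    (hRdef : R = U * Matrix.diagonal (fun i => (BargmannPhase.mu ρ lam i : ℂ)) * X *
      Matrix.diagonal (fun i => (lam i : ℂ)) * Uᵀ) :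
    GaussianPair H R ∧ ∃ T : Matrix (Fin n) (Fin n) ℂ, Tᵀ = T ∧ R = T * Hᵀ ∧
      H = ((ρ : ℂ) ^ 2) • (1 : Matrix (Fin n) (Fin n) ℂ) + T * Rᴴ := by
  have hU1 : Uᴴ * U = 1 := Matrix.mem_unitaryGroup_iff'.1 hU
  have hU2 : U * Uᴴ = 1 := Matrix.mem_unitaryGroup_iff.1 hU
  have hU3 : Uᵀ * (Uᴴ)ᵀ = 1 := by rw [← Matrix.transpose_mul, hU1, Matrix.transpose_one]
  have hX1 : Xᴴ * X = 1 := Matrix.mem_unitaryGroup_iff'.1 hX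
  have hX2 : X * Xᴴ = 1 := Matrix.mem_unitaryGroup_iff.1 hX
  have hX3 : (Xᴴ)ᵀ * Xᵀ = 1 := by rw [← Matrix.transpose_mul, hX2, Matrix.transpose_one]
  set m : Fin n → ℝ := fun i => BargmannPhase.mu ρ lam i / lam i with hm
  have hm0 : ∀ i, 0 ≤ m i := fun i => div_nonneg (Real.sqrt_nonneg _) (hlam i).le
  have hmlam : ∀ i, m i * lam i = BargmannPhase.mu ρ lam i := fun i =>
    div_mul_cancel₀ _ (hlam i).ne'
  have hmsq : ∀ i, m i ^ 2 * lam i ^ 2 = lam i ^ 2 - ρ ^ 2 := by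
    intro i
    rw [← mul_pow, hmlam, BargmannPhase.mu, Real.sq_sqrt]
    nlinarith [hρlam i]
  have hm1 : ∀ i, m i < 1 := by
    intro i
    have h2 : 0 < lam i ^ 2 := pow_pos (hlam i) 2
    have : m i ^ 2 < 1 := by
      by_contra hcon
      have := mul_le_mul_of_nonneg_right (not_lt.1 hcon) h2.le
      nlinarith [hmsq i]
    nlinarith [hm0 i]
  set D : Matrix (Fin n) (Fin n) ℂ := Matrix.diagonal fun i => (lam i : ℂ) with hD
  set N : Matrix (Fin n) (Fin n) ℂ := Matrix.diagonal fun i => ((m i : ℝ) : ℂ) with hN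
  -- The hypothesis on X says exactly that K is symmetric. Then R = U D K D ᵗU and H = U D² U*.
  set K : Matrix (Fin n) (Fin n) ℂ := N * X with hK
  have hDt : Dᵀ = D := Matrix.diagonal_transpose _
  have hNt : Nᵀ = N := Matrix.diagonal_transpose _
  have hDh : Dᴴ = D := by
    rw [hD, Matrix.diagonal_conjTranspose]
    congr 1
    ext i
    simp
  have hNh : Nᴴ = N := by
    rw [hN, Matrix.diagonal_conjTranspose]
    congr 1
    ext i
    simp
  have hKt : Kᵀ = K := by rw [hK, Matrix.transpose_mul, hNt, hXsymm]
  have hKK : K * Kᴴ = N * N := by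
    rw [hK, Matrix.conjTranspose_mul, hNh, Matrix.mul_assoc, ← Matrix.mul_assoc X, hX2,
      Matrix.one_mul]
  have hKK' : Kᴴ * K = N * N := by
    have h1 : Kᴴ = N * (Xᴴ)ᵀ := by
      rw [← hKt, Matrix.conjTranspose_transpose_eq_transpose_conjTranspose, hK, Matrix.conjTranspose_mul, hNh,
        Matrix.transpose_mul, hNt]
    rw [h1]
    nth_rewrite 1 [← hKt]
    rw [hK, Matrix.transpose_mul, hNt, Matrix.mul_assoc, ← Matrix.mul_assoc (Xᴴᵀ), hX3,
      Matrix.one_mul]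
  -- K K* = K* K = N² makes K commute with N². As mᵢ² = 1 - ρ²/λᵢ² determines λᵢ > 0, a nonzero
  -- entry of K only links indices with equal λ, so K commutes with D as well.
  have hKD : K * D = D * K := by
    have h1 : K * (N * N) = N * N * K := by
      rw [← hKK', ← Matrix.mul_assoc, hKK, hKK']
    ext i j
    have h2 := congrFun (congrFun h1 i) j
    simp only [hN, Matrix.diagonal_mul_diagonal, Matrix.mul_diagonal, Matrix.diagonal_mul] at h2
    simp only [hD, Matrix.mul_diagonal, Matrix.diagonal_mul]
    rcases eq_or_ne (K i j) 0 with h0 | h0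
    · simp [h0]
    · rw [mul_comm] at h2
      have h3 : m j ^ 2 = m i ^ 2 := by
        have := mul_right_cancel₀ h0 h2
        rw [sq, sq]
        exact_mod_cast this
      have h4 : lam j ^ 2 = lam i ^ 2 := by
        have hi := hmsq i
        have hj := hmsq j
        rw [h3] at hj
        have h5 : (1 - m i ^ 2) * lam j ^ 2 = (1 - m i ^ 2) * lam i ^ 2 := by linarith
        refine mul_left_cancel₀ ?_ h5
        nlinarith [hm0 i, hm1 i]
      have h6 : lam j = lam i := (sq_eq_sq₀ (hlam j).le (hlam i).le).1 h4
      rw [h6, mul_comm]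
  have hR : R = U * (D * K * D) * Uᵀ := by
    rw [hRdef]
    have : Matrix.diagonal (fun i => (BargmannPhase.mu ρ lam i : ℂ)) = D * N := by
      rw [hD, hN, Matrix.diagonal_mul_diagonal]
      congr 1
      ext i
      rw [← hmlam]
      push_cast
      ring
    rw [this, hK]
    simp only [Matrix.mul_assoc]
  have hH : H = U * (D * D) * Uᴴ := by
    have h1 : D * D = Uᴴ * H * U := by
      rw [hdiag, hD, Matrix.diagonal_mul_diagonal]
      congr 1
      ext i
      ring
    rw [h1]
    calc H = (U * Uᴴ) * H * (U * Uᴴ) := by rw [hU2, Matrix.one_mul, Matrix.mul_one]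
      _ = _ := by simp only [Matrix.mul_assoc]
  have hHh : H.IsHermitian := by
    rw [Matrix.IsHermitian, hH]
    simp only [Matrix.conjTranspose_mul, Matrix.conjTranspose_conjTranspose, hDh, Matrix.mul_assoc]
  have hform : ∀ z, hermForm H z = sqNorm (D *ᵥ (Uᵀ *ᵥ z)) := by
    intro z
    have h1 : sesq H z z = ((sqNorm (D *ᵥ (Uᵀ *ᵥ z)) : ℝ) : ℂ) := by
      rw [ofReal_sqNorm, sesq, hH, star_mulVec_eq, star_mulVec_eq, hDh, hDt, mulVec_dotProduct,
        mulVec_dotProduct, hDt, Matrix.conjTranspose_transpose_eq_transpose_conjTranspose,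
        Matrix.transpose_transpose, Matrix.transpose_transpose]
      simp only [Matrix.mulVec_mulVec, Matrix.mul_assoc]
    rw [hermForm, h1, Complex.ofReal_re]
  have hRform : ∀ z, z ⬝ᵥ R *ᵥ z
      = (N *ᵥ (D *ᵥ (Uᵀ *ᵥ z))) ⬝ᵥ (X *ᵥ (D *ᵥ (Uᵀ *ᵥ z))) := by
    intro z
    rw [mulVec_dotProduct, mulVec_dotProduct, mulVec_dotProduct, hNt, hDt,
      Matrix.transpose_transpose, hR, hK]
    simp only [Matrix.mulVec_mulVec, Matrix.mul_assoc]
  -- The lower bound ρ² for H comes from ρ < λᵢ, and the contraction constant will be max mᵢ < 1.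
  -- With S = U K ᵗU, the identity H = ρ² + S R* reduces to λᵢ² = ρ² + mᵢ²λᵢ².
  refine ⟨⟨⟨hHh, ρ ^ 2, by positivity, fun z => ?_⟩, ?_, ?_⟩, U * K * Uᵀ, ?_, ?_, ?_⟩
  · have hUt : (Uᵀ)ᴴ * Uᵀ = 1 := by
      rw [Matrix.conjTranspose_transpose_eq_transpose_conjTranspose, ← Matrix.transpose_mul, hU2, Matrix.transpose_one]
    rw [hform, ← sqNorm_mulVec hUt z]
    simp only [sqNorm, Finset.mul_sum]
    refine Finset.sum_le_sum fun i _ => ?_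
    rw [hD, Matrix.mulVec_diagonal, norm_mul, mul_pow, Complex.norm_real, Real.norm_of_nonneg
      (hlam i).le]
    gcongr
    exact (hρlam i).le
  · rw [hR]
    simp only [Matrix.transpose_mul, Matrix.transpose_transpose, hDt, hKt, Matrix.mul_assoc]
  · have : Nonempty (Fin n) := ⟨⟨0, hn⟩⟩
    obtain ⟨i₀, hi₀⟩ := Finite.exists_max m
    refine ⟨m i₀, hm0 i₀, hm1 i₀, fun z => ?_⟩
    rw [hRform, hform]
    set w := D *ᵥ (Uᵀ *ᵥ z)
    have h1 : (N *ᵥ w) ⬝ᵥ (X *ᵥ w) = ∑ i, ((m i : ℝ) : ℂ) * (w i * (X *ᵥ w) i) := by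
      simp only [dotProduct, hN, Matrix.mulVec_diagonal, mul_assoc]
    rw [h1]
    calc ‖∑ i, ((m i : ℝ) : ℂ) * (w i * (X *ᵥ w) i)‖
        ≤ ∑ i, m i₀ * ((‖w i‖ ^ 2 + ‖(X *ᵥ w) i‖ ^ 2) / 2) := by
          refine (norm_sum_le _ _).trans (Finset.sum_le_sum fun i _ => ?_)
          rw [norm_mul, norm_mul, Complex.norm_real, Real.norm_of_nonneg (hm0 i)]
          refine mul_le_mul (hi₀ i) ?_ (by positivity) (hm0 i₀)
          nlinarith [sq_nonneg (‖w i‖ - ‖(X *ᵥ w) i‖)]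
      _ = m i₀ * ((sqNorm w + sqNorm (X *ᵥ w)) / 2) := by
          rw [← Finset.mul_sum, ← Finset.sum_div, Finset.sum_add_distrib]
          rfl
      _ = m i₀ * sqNorm w := by rw [sqNorm_mulVec hX1]; ring
  · simp only [Matrix.transpose_mul, Matrix.transpose_transpose, hKt, Matrix.mul_assoc]
  · calc R = U * (K * D * D) * Uᵀ := by rw [hR, hKD]
      _ = U * K * (Uᵀ * (Uᴴ)ᵀ) * (D * D) * Uᵀ := by
          rw [hU3, Matrix.mul_one]; simp only [Matrix.mul_assoc]
      _ = U * K * Uᵀ * Hᵀ := by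
          rw [hH]; simp only [Matrix.transpose_mul, Matrix.mul_assoc, hDt]
  · have h1 : Rᴴ = (Uᴴ)ᵀ * (D * Kᴴ * D) * Uᴴ := by
      rw [hR]
      simp only [Matrix.conjTranspose_mul, hDh, Matrix.mul_assoc,
        Matrix.conjTranspose_transpose_eq_transpose_conjTranspose]
    have h2 : U * K * Uᵀ * Rᴴ = U * (D * (N * N) * D) * Uᴴ := by
      calc U * K * Uᵀ * Rᴴ = U * K * (Uᵀ * (Uᴴ)ᵀ) * (D * Kᴴ * D) * Uᴴ := by
            rw [h1]; simp only [Matrix.mul_assoc]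
        _ = U * (K * D) * Kᴴ * D * Uᴴ := by rw [hU3, Matrix.mul_one]; simp only [Matrix.mul_assoc]
        _ = U * (D * (K * Kᴴ) * D) * Uᴴ := by rw [hKD]; simp only [Matrix.mul_assoc]
        _ = _ := by rw [hKK]
    have h3 : D * D = ((ρ : ℂ) ^ 2) • (1 : Matrix (Fin n) (Fin n) ℂ) + D * (N * N) * D := by
      rw [hD, hN, Matrix.smul_one_eq_diagonal]
      simp only [Matrix.diagonal_mul_diagonal, Matrix.diagonal_add]
      congr 1
      ext i
      have := congrArg (Complex.ofReal) (hmsq i)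
      push_cast at this
      linear_combination -this
    rw [h2]
    conv_lhs => rw [hH, h3]
    rw [Matrix.mul_add, Matrix.add_mul, Matrix.mul_smul, Matrix.mul_one, Matrix.smul_mul, hU2]

end MatrixAlgebra

/-! ### Reduction to the weight exp(-2⟨z, H z̄⟩), and completeness of the space. -/

namespace BargmannPhase

variable {n : ℕ} (P : BargmannPhase n)

theorem hessHol_symm : P.hessHolᵀ = P.hessHol := by
  have hCI : P.CIᵀ = P.CI := by
    rw [P.CI_eq, ← Matrix.transpose_map, P.imC_symm]
  simp only [hessHol, Matrix.transpose_sub, Matrix.transpose_neg, Matrix.transpose_smul,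
    Matrix.transpose_mul, Matrix.transpose_transpose, Matrix.transpose_nonsing_inv, hCI, P.symm_A,
    Matrix.mul_assoc]

/-- Division by `exp ⟨z, Φ''_{zz} z⟩`, which removes the pluriharmonic part of the weight. -/
def trivialize (F : (Fin n → ℂ) → ℂ) (z : Fin n → ℂ) : ℂ :=
  F z * Complex.exp (-(z ⬝ᵥ P.hessHol *ᵥ z))

theorem differentiable_trivialize {F : (Fin n → ℂ) → ℂ} (hF : Differentiable ℂ F) :
    Differentiable ℂ (P.trivialize F) :=
  hF.mul (differentiable_dotProduct_mulVec P.hessHol).neg.cexp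

/-- Twice the real part of ⟨z, Φ''_zz z⟩ is the sum of this function and its conjugate, so its
exponential splits into one factor for each entry of the inner product. -/
theorem conj_trivialize_mul (F G : (Fin n → ℂ) → ℂ) (z : Fin n → ℂ)
    (hH : P.hessMixed.IsHermitian) :
    starRingEnd ℂ (P.trivialize F z) * P.trivialize G z * gauss P.hessMixed z ^ 2
      = ((Real.exp (-2 * P.weight z) : ℝ) : ℂ) * (starRingEnd ℂ (F z) * G z) := by
  have h1 : ((P.weight z : ℝ) : ℂ) = sesq P.hessMixed z z
      + (z ⬝ᵥ P.hessHol *ᵥ z + starRingEnd ℂ (z ⬝ᵥ P.hessHol *ᵥ z)) / 2 := by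
    rw [P.weight_eq, Complex.add_conj, ← ofReal_hermForm hH, hermForm, sesq]
    push_cast
    ring
  rw [gauss_sq hH]
  simp only [trivialize, map_mul, ← Complex.exp_conj, Complex.ofReal_exp, map_neg]
  push_cast
  rw [h1]
  have h2 : Complex.exp (-2 * (sesq P.hessMixed z z
      + (z ⬝ᵥ P.hessHol *ᵥ z + starRingEnd ℂ (z ⬝ᵥ P.hessHol *ᵥ z)) / 2))
      = Complex.exp (-(starRingEnd ℂ (z ⬝ᵥ P.hessHol *ᵥ z)))
        * Complex.exp (-(z ⬝ᵥ P.hessHol *ᵥ z)) * Complex.exp (-2 * sesq P.hessMixed z z) := by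
    rw [← Complex.exp_add, ← Complex.exp_add]
    ring_nf
  rw [h2]
  ring

theorem measurable_density :
    Measurable fun z => ENNReal.ofReal (Real.exp (-2 * P.weight z)) := by
  have := P.continuous_weight
  fun_prop

theorem integral_weightMeasure (g : (Fin n → ℂ) → ℂ) :
    ∫ z, g z ∂P.weightMeasure = ∫ z, ((Real.exp (-2 * P.weight z) : ℝ) : ℂ) * g z := by
  rw [weightMeasure, integral_withDensity_eq_integral_toReal_smul P.measurable_density
    (Filter.Eventually.of_forall fun z => ENNReal.ofReal_lt_top)]
  refine integral_congr_ae (Filter.Eventually.of_forall fun z => ?_)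
  simp only [ENNReal.toReal_ofReal (Real.exp_pos _).le, Complex.real_smul]

theorem memLp_weightMeasure_iff (hH : P.hessMixed.IsHermitian) {F : (Fin n → ℂ) → ℂ}
    (hF : Continuous F) :
    MemLp F 2 P.weightMeasure
      ↔ MemLp (fun z => P.trivialize F z * gauss P.hessMixed z) 2 volume := by
  have hc : Continuous fun z => P.trivialize F z * gauss P.hessMixed z :=
    (hF.mul (differentiable_dotProduct_mulVec P.hessHol).neg.cexp.continuous).mul continuous_gauss
  rw [memLp_two_iff_integrable_sq_norm hF.aestronglyMeasurable,
    memLp_two_iff_integrable_sq_norm hc.aestronglyMeasurable, weightMeasure,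
    integrable_withDensity_iff_integrable_smul' P.measurable_density
      (Filter.Eventually.of_forall fun z => ENNReal.ofReal_lt_top)]
  refine integrable_congr (Filter.Eventually.of_forall fun z => ?_)
  simp only [ENNReal.toReal_ofReal (Real.exp_pos _).le, smul_eq_mul]
  have h := P.conj_trivialize_mul F F z hH
  rw [Complex.conj_mul', Complex.conj_mul'] at h
  have h2 : gauss P.hessMixed z ^ 2 = (‖gauss P.hessMixed z‖ : ℂ) ^ 2 := by
    rw [norm_gauss, gauss]
  rw [h2] at h
  rw [norm_mul, mul_pow]
  exact_mod_cast h.symm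

theorem mem_holL2_iff (hH : P.hessMixed.IsHermitian) {F : (Fin n → ℂ) → ℂ} :
    F ∈ P.holL2 ↔ Differentiable ℂ F
      ∧ MemLp (fun z => P.trivialize F z * gauss P.hessMixed z) 2 volume :=
  and_congr_right fun hF => P.memLp_weightMeasure_iff hH hF.continuous

theorem inner_eq (hH : P.hessMixed.IsHermitian) (F G : P.SegalBargmann) :
    inner ℂ F G = ∫ z, starRingEnd ℂ (P.trivialize F z) * P.trivialize G z
      * gauss P.hessMixed z ^ 2 := by
  have : inner ℂ F G = ∫ z, starRingEnd ℂ (F z) * G z ∂P.weightMeasure := rfl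
  rw [this, P.integral_weightMeasure]
  simp only [P.conj_trivialize_mul F G _ hH]

theorem memLp_trivialize (hH : P.hessMixed.IsHermitian) (F : P.SegalBargmann) :
    MemLp (fun z => P.trivialize F z * gauss P.hessMixed z) 2 volume :=
  ((P.mem_holL2_iff hH).1 F.2).2

/-- The isometric embedding of the Segal-Bargmann space in `L²(ℂⁿ)`. -/
def toL2 (hH : P.hessMixed.IsHermitian) :
    P.SegalBargmann →ₗᵢ[ℂ] Lp ℂ 2 (volume : Measure (Fin n → ℂ)) :=
  LinearMap.isometryOfInner
    { toFun := fun F => (P.memLp_trivialize hH F).toLp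
      map_add' := fun F G => by
        rw [← MemLp.toLp_add]
        refine MemLp.toLp_congr _ _ (Filter.Eventually.of_forall fun z => ?_)
        change (F z + G z) * _ * _ = F z * _ * _ + G z * _ * _
        ring
      map_smul' := fun c F => by
        rw [RingHom.id_apply, ← MemLp.toLp_const_smul]
        refine MemLp.toLp_congr _ _ (Filter.Eventually.of_forall fun z => ?_)
        change (c * F z) * _ * _ = c * (F z * _ * _)
        ring }
    (fun F G => by
      rw [P.inner_eq hH, L2.inner_def]
      refine integral_congr_ae ?_
      filter_upwards [(P.memLp_trivialize hH F).coeFn_toLp, (P.memLp_trivialize hH G).coeFn_toLp]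
        with z h1 h2
      simp only [LinearMap.coe_mk, AddHom.coe_mk]
      rw [h1, h2, RCLike.inner_apply, map_mul, conj_gauss]
      ring)

theorem coeFn_toL2 (hH : P.hessMixed.IsHermitian) (F : P.SegalBargmann) :
    P.toL2 hH F =ᵐ[volume] fun z => P.trivialize F z * gauss P.hessMixed z :=
  (P.memLp_trivialize hH F).coeFn_toLp

theorem inner_toLp_toL2 (hH : P.hessMixed.IsHermitian) {u : (Fin n → ℂ) → ℂ}
    (hu : MemLp (fun z => u z * gauss P.hessMixed z) 2 volume) (F : P.SegalBargmann) :
    inner ℂ hu.toLp (P.toL2 hH F)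
      = ∫ z, starRingEnd ℂ (u z) * P.trivialize F z * gauss P.hessMixed z ^ 2 := by
  rw [L2.inner_def]
  refine integral_congr_ae ?_
  filter_upwards [hu.coeFn_toLp, P.coeFn_toL2 hH F] with z h1 h2
  rw [h1, h2, RCLike.inner_apply, map_mul, conj_gauss]
  ring

/-- The image in L² is closed. Pairing with the kernel makes an L² limit into a pointwise limit φ,
which is entire as an integral against the kernel, and φ agrees almost everywhere with the L² limit.
-/
theorem completeSpace (hH : IsPosHerm P.hessMixed) : CompleteSpace P.SegalBargmann := by
  have hHh := hH.1
  refine (completeSpace_iff_isComplete_range (P.toL2 hHh).isometry.isUniformInducing).2 ?_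
  refine IsClosed.isComplete ?_
  refine isClosed_of_closure_subset fun g hg => ?_
  obtain ⟨F, hF⟩ := mem_closure_iff_seq_limit.1 hg
  obtain ⟨hFr, hFl⟩ := hF
  choose f hf using hFr
  set s : (Fin n → ℂ) → ℂ := fun z => g z * (gauss P.hessMixed z)⁻¹ with hs
  have hsg : (fun z => s z * gauss P.hessMixed z) = g := by
    funext z
    rw [hs]
    simp only
    rw [inv_mul_cancel_right₀ (gauss_ne_zero z)]
  have hs2 : MemLp (fun z => s z * gauss P.hessMixed z) 2 volume := by
    rw [hsg]
    exact Lp.memLp g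
  have hc0 := integral_gauss_sq_ne_zero hH
  set c := ∫ z, gauss P.hessMixed z ^ 2 with hc
  set φ : (Fin n → ℂ) → ℂ := fun a => c⁻¹ *
    ∫ z, s z * Complex.exp (2 * sesq P.hessMixed a z) * gauss P.hessMixed z ^ 2 with hφ
  have hφd : Differentiable ℂ φ := (differentiable_integral_exp_sesq hH hs2).const_mul _
  have hk : ∀ a, MemLp (fun z => starRingEnd ℂ (Complex.exp (2 * sesq P.hessMixed a z))
      * gauss P.hessMixed z) 2 volume := fun a =>
    (subGaussian_exp_sesq (H := P.hessMixed) a).star.memLp_mul_gauss hH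
  have hpt : ∀ a, Filter.Tendsto (fun m => P.trivialize (f m) a) Filter.atTop (nhds (φ a)) := by
    intro a
    have h1 : Filter.Tendsto (fun m => c⁻¹ * inner ℂ (hk a).toLp (F m)) Filter.atTop
        (nhds (c⁻¹ * inner ℂ (hk a).toLp g)) :=
      ((continuous_const.inner continuous_id).tendsto g |>.comp hFl).const_mul _
    have h2 : ∀ m, c⁻¹ * inner ℂ (hk a).toLp (F m) = P.trivialize (f m) a := by
      intro m
      rw [← hf m, P.inner_toLp_toL2 hHh (hk a)]
      have := integral_exp_sesq hH (P.differentiable_trivialize (f m).2.1)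
        (P.memLp_trivialize hHh (f m)) a
      simp only [Complex.conj_conj]
      rw [inv_mul_eq_iff_eq_mul₀ hc0, mul_comm c, ← this]
      refine integral_congr_ae (Filter.Eventually.of_forall fun z => ?_)
      ring
    have h3 : c⁻¹ * inner ℂ (hk a).toLp g = φ a := by
      rw [hφ, L2.inner_def]
      congr 1
      refine integral_congr_ae ?_
      filter_upwards [(hk a).coeFn_toLp] with z h1
      rw [h1, RCLike.inner_apply, map_mul, conj_gauss, Complex.conj_conj]
      have := congrFun hsg z
      rw [← this]
      ring
    simpa only [h2, h3] using h1
  -- L² convergence gives almost everywhere convergence only along a subsequence, which is enough to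
  -- identify the two limits.
  obtain ⟨ns, hns', hns⟩ := (tendstoInMeasure_of_tendsto_Lp hFl).exists_seq_tendsto_ae
  have hae : ∀ᵐ z, φ z * gauss P.hessMixed z = g z := by
    have hall : ∀ᵐ z, ∀ m, F m z = P.trivialize (f m) z * gauss P.hessMixed z := by
      rw [ae_all_iff]
      intro m
      rw [← hf m]
      exact P.coeFn_toL2 hHh (f m)
    filter_upwards [hns, hall] with z h1 h2
    simp only [h2] at h1
    exact tendsto_nhds_unique (((hpt z).comp hns'.tendsto_atTop).mul_const _) h1
  set G : (Fin n → ℂ) → ℂ := fun z => φ z * Complex.exp (z ⬝ᵥ P.hessHol *ᵥ z) with hG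
  have htriv : P.trivialize G = φ := by
    funext z
    rw [trivialize, hG]
    simp only
    rw [mul_assoc, ← Complex.exp_add, add_neg_cancel, Complex.exp_zero, mul_one]
  have hGm : G ∈ P.holL2 := by
    rw [P.mem_holL2_iff hHh]
    refine ⟨hφd.mul (differentiable_dotProduct_mulVec P.hessHol).cexp, ?_⟩
    rw [htriv]
    exact (memLp_congr_ae hae).2 (Lp.memLp g)
  refine ⟨⟨G, hGm⟩, Lp.ext ?_⟩
  filter_upwards [P.coeFn_toL2 hHh ⟨G, hGm⟩, hae] with z h1 h2
  rw [h1, ← h2]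
  rw [htriv]

end BargmannPhase

/-! ### The adjoint relation between ∂ᵢ and the creation operators on polynomials. -/

section Pairing

variable {n : ℕ} {H R T : Matrix (Fin n) (Fin n) ℂ} {ρ : ℝ}

/-- `2 (H z̄ + R z)ᵢ`: the adjoint of `∂/∂zᵢ + 2(Rz)ᵢ` in `L²`, up to conjugation. -/
def adjSymbol (H R : Matrix (Fin n) (Fin n) ℂ) (z : Fin n → ℂ) (i : Fin n) : ℂ :=
  2 * ((H *ᵥ star z) i + (R *ᵥ z) i)

/-- The adjoint symbols are, up to the relation matrix `T`, the coordinate functions. -/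
structure LadderData (H R T : Matrix (Fin n) (Fin n) ℂ) (ρ : ℝ) : Prop where
  pair : GaussianPair H R
  pos : 0 < ρ
  symm : Tᵀ = T
  relation : ∀ z i, starRingEnd ℂ (2 * (ρ : ℂ) ^ 2 * z i + ∑ k, T i k * adjSymbol H R z k)
    = adjSymbol H R z i

/-- Conjugating the symbol gives 2(ᵗH z + R* z̄). Applying S yields 2(Rz + (H - ρ²) z̄), and adding
2ρ² z̄ restores the symbol. -/
theorem LadderData.of_matrix (h : GaussianPair H R) (hρ : 0 < ρ) {S : Matrix (Fin n) (Fin n) ℂ}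
    (hS : Sᵀ = S) (h1 : R = S * Hᵀ)
    (h2 : H = ((ρ : ℂ) ^ 2) • (1 : Matrix (Fin n) (Fin n) ℂ) + S * Rᴴ) :
    LadderData H R Sᴴ ρ := by
  have hHh : Hᴴ = H := h.posHerm.1
  refine ⟨h, hρ, ?_, fun z i => ?_⟩
  · rw [← Matrix.conjTranspose_transpose_eq_transpose_conjTranspose, hS]
  · have hvec : adjSymbol H R z = (2 : ℂ) • (H *ᵥ star z + R *ᵥ z) := by
      funext i
      simp [adjSymbol]
    have hstar : star (adjSymbol H R z) = (2 : ℂ) • (Hᵀ *ᵥ z + Rᴴ *ᵥ star z) := by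
      rw [hvec, star_smul, star_add, star_mulVec_eq, star_mulVec_eq, star_star, hHh,
        ← Matrix.conjTranspose_transpose_eq_transpose_conjTranspose, h.symm]
      simp
    have hk : ∀ k, starRingEnd ℂ (Sᴴ i k) = S i k := by
      intro k
      have := congrFun (congrFun hS i) k
      simp only [Matrix.transpose_apply] at this
      simp [this]
    have hsum : starRingEnd ℂ (∑ k, Sᴴ i k * adjSymbol H R z k)
        = (S *ᵥ star (adjSymbol H R z)) i := by
      simp only [map_sum, map_mul, hk, Matrix.mulVec, dotProduct, Pi.star_apply, Complex.star_def]
    rw [map_add, hsum, hstar, Matrix.mulVec_smul, Matrix.mulVec_add, Matrix.mulVec_mulVec,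
      Matrix.mulVec_mulVec, ← h1, eq_sub_of_add_eq' h2.symm, Matrix.sub_mulVec,
      Matrix.smul_mulVec, Matrix.one_mulVec, hvec]
    have h2 : starRingEnd ℂ 2 = 2 := Complex.conj_ofNat 2
    simp [h2]
    ring

theorem subGaussian_adjSymbol (H R : Matrix (Fin n) (Fin n) ℂ) (i : Fin n) :
    SubGaussian fun z => adjSymbol H R z i :=
  (SubGaussian.const 2).mul ((SubGaussian.mulVec_star H i).add (SubGaussian.mulVec R i))

theorem integral_polyGauss_pderiv (h : GaussianPair H R) (i : Fin n)
    (p q : MvPolynomial (Fin n) ℂ) :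
    ∫ z, starRingEnd ℂ (polyGauss R p z) * polyGauss R (MvPolynomial.pderiv i q) z * gauss H z ^ 2
      = ∫ z, adjSymbol H R z i * (starRingEnd ℂ (polyGauss R p z) * polyGauss R q z
        * gauss H z ^ 2) := by
  have e1 : ∀ z, fderiv ℂ (polyGauss R q) z (Pi.single i 1) + 2 * (R *ᵥ z) i * polyGauss R q z
      = polyGauss R (MvPolynomial.pderiv i q) z := by
    intro z
    rw [polyGauss_fderiv h.symm]
    ring
  have key := integral_conj_polyGauss_mul h (differentiable_polyGauss q) (memLp_polyGauss h q) i
    (by simpa only [e1] using memLp_polyGauss h (MvPolynomial.pderiv i q)) p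
  simp only [e1] at key
  rw [key]
  refine integral_congr_ae (Filter.Eventually.of_forall fun z => ?_)
  simp only [adjSymbol]
  ring

/-- In the conjugated entry each ∂ₖ may be traded for the factor conj(`adjSymbol` k). The whole
operator then becomes the factor that `relation` identifies with `adjSymbol` i, which is ∂ᵢ acting
on the other entry. -/
theorem integral_creationPoly (h : LadderData H R T ρ) (i : Fin n)
    (p q : MvPolynomial (Fin n) ℂ) :
    ∫ z, starRingEnd ℂ (polyGauss R (creationPoly (2 * (ρ : ℂ) ^ 2) T i p) z) * polyGauss R q z
        * gauss H z ^ 2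
      = ∫ z, starRingEnd ℂ (polyGauss R p z) * polyGauss R (MvPolynomial.pderiv i q) z
        * gauss H z ^ 2 := by
  have hint : ∀ u, SubGaussian u → ∀ p : MvPolynomial (Fin n) ℂ,
      Integrable fun z => starRingEnd ℂ (u z) *
        (starRingEnd ℂ (polyGauss R p z) * polyGauss R q z * gauss H z ^ 2) := by
    intro u hu p
    refine (integrable_mul_gauss_sq (memLp_conj_mul_gauss (hu.memLp_mul_polyGauss h.pair p))
      (memLp_polyGauss h.pair q)).congr (Filter.Eventually.of_forall fun z => ?_)
    simp only [map_mul]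
    ring
  have hk : ∀ k, ∫ z, starRingEnd ℂ (polyGauss R (MvPolynomial.pderiv k p) z) * polyGauss R q z
        * gauss H z ^ 2
      = ∫ z, starRingEnd ℂ (adjSymbol H R z k) *
        (starRingEnd ℂ (polyGauss R p z) * polyGauss R q z * gauss H z ^ 2) := by
    intro k
    have := congrArg (starRingEnd ℂ) (integral_polyGauss_pderiv h.pair k q p)
    rw [← integral_conj, ← integral_conj] at this
    simp only [map_mul, map_pow, conj_gauss, Complex.conj_conj] at this
    simp only [mul_comm (starRingEnd ℂ (polyGauss R _ _)) (polyGauss R q _)]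
    exact this
  have he : ∀ z, starRingEnd ℂ (polyGauss R (creationPoly (2 * (ρ : ℂ) ^ 2) T i p) z)
        * polyGauss R q z * gauss H z ^ 2
      = starRingEnd ℂ (2 * (ρ : ℂ) ^ 2 * z i) *
          (starRingEnd ℂ (polyGauss R p z) * polyGauss R q z * gauss H z ^ 2)
        + ∑ k, starRingEnd ℂ (T i k) *
          (starRingEnd ℂ (1 : ℂ) * (starRingEnd ℂ (polyGauss R (MvPolynomial.pderiv k p) z)
            * polyGauss R q z * gauss H z ^ 2)) := by
    intro z
    have : polyGauss R (creationPoly (2 * (ρ : ℂ) ^ 2) T i p) z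
        = 2 * (ρ : ℂ) ^ 2 * z i * polyGauss R p z
          + ∑ k, T i k * polyGauss R (MvPolynomial.pderiv k p) z := by
      simp only [creationPoly_apply, polyGauss, map_add, map_sum, MvPolynomial.smul_eval, map_mul,
        MvPolynomial.eval_X, add_mul, Finset.sum_mul, mul_assoc]
    rw [this, map_add, map_sum]
    simp only [map_mul, add_mul, Finset.sum_mul, map_one, one_mul, mul_assoc]
  simp only [he]
  rw [integral_add (hint _ ((SubGaussian.const _).mul (SubGaussian.eval i)) p)
    (integrable_finsetSum _ fun k _ => (hint _ (SubGaussian.const 1) _).const_mul _),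
    integral_finsetSum _ fun k _ => (hint _ (SubGaussian.const 1) _).const_mul _]
  simp only [integral_const_mul, map_one, one_mul, hk]
  simp only [← integral_const_mul]
  rw [← integral_finsetSum _ fun k _ => (hint _ (subGaussian_adjSymbol H R k) p).const_mul _,
    ← integral_add (hint _ ((SubGaussian.const _).mul (SubGaussian.eval i)) p)
    (integrable_finsetSum _ fun k _ => (hint _ (subGaussian_adjSymbol H R k) p).const_mul _),
    integral_polyGauss_pderiv h.pair]
  refine integral_congr_ae (Filter.Eventually.of_forall fun z => ?_)
  simp only
  rw [← h.relation z i, map_add, map_sum, add_mul, Finset.sum_mul]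
  simp only [map_mul, mul_assoc]

end Pairing

/-! ### The Hilbert space adjoint on polynomials times the generator. -/

namespace BargmannPhase

variable {n : ℕ} (P : BargmannPhase n) {Q T : Matrix (Fin n) (Fin n) ℂ} {ρ : ℝ}

theorem trivialize_polyGauss (p : MvPolynomial (Fin n) ℂ) :
    P.trivialize (polyGauss Q p) = polyGauss (Q + P.hessHol) p := by
  funext z
  rw [trivialize, polyGauss, polyGauss, mul_assoc, ← Complex.exp_add, Matrix.add_mulVec,
    dotProduct_add]
  ring_nf

theorem trivialize_annihilationExpr (i : Fin n) {F : (Fin n → ℂ) → ℂ} (hF : Differentiable ℂ F)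
    (z : Fin n → ℂ) :
    P.trivialize (annihilationExpr Q i F) z = fderiv ℂ (P.trivialize F) z (Pi.single i 1)
      + 2 * ((Q + P.hessHol) *ᵥ z) i * P.trivialize F z := by
  have h2 := (differentiable_dotProduct_mulVec P.hessHol z).hasFDerivAt.neg.cexp
  have h3 : HasFDerivAt (P.trivialize F) _ z := (hF z).hasFDerivAt.mul h2
  simp only [Pi.neg_apply] at h3
  rw [h3.fderiv]
  simp only [add_apply, smul_apply, smul_eq_mul, neg_apply,
    fderiv_dotProduct_mulVec_single P.hessHol_symm, trivialize, annihilationExpr,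
    Matrix.add_mulVec, Pi.add_apply]
  ring

theorem polyGauss_mem (h : LadderData P.hessMixed (Q + P.hessHol) T ρ)
    (p : MvPolynomial (Fin n) ℂ) : polyGauss Q p ∈ P.holL2 := by
  rw [P.mem_holL2_iff h.pair.posHerm.1, trivialize_polyGauss]
  exact ⟨differentiable_polyGauss p, memLp_polyGauss h.pair p⟩

theorem matrix_symm (h : LadderData P.hessMixed (Q + P.hessHol) T ρ) : Qᵀ = Q := by
  have := h.pair.symm
  rwa [Matrix.transpose_add, P.hessHol_symm, add_left_inj] at this

theorem annihilationExpr_polyGauss (h : LadderData P.hessMixed (Q + P.hessHol) T ρ) (i : Fin n)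
    (p : MvPolynomial (Fin n) ℂ) :
    annihilationExpr Q i (polyGauss Q p) = polyGauss Q (MvPolynomial.pderiv i p) := by
  funext z
  rw [annihilationExpr, polyGauss_fderiv (P.matrix_symm h)]
  ring

/-- Polynomials times the generator, as elements of the Segal-Bargmann space. -/
def polyElt (h : LadderData P.hessMixed (Q + P.hessHol) T ρ) :
    MvPolynomial (Fin n) ℂ →ₗ[ℂ] P.SegalBargmann where
  toFun p := ⟨polyGauss Q p, P.polyGauss_mem h p⟩
  map_add' p q := by
    refine Subtype.ext (funext fun z => ?_)
    change polyGauss Q (p + q) z = polyGauss Q p z + polyGauss Q q z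
    simp only [polyGauss, map_add, add_mul]
  map_smul' c p := by
    refine Subtype.ext (funext fun z => ?_)
    change polyGauss Q (c • p) z = c * polyGauss Q p z
    simp only [polyGauss, MvPolynomial.smul_eval, mul_assoc]

variable (h : LadderData P.hessMixed (Q + P.hessHol) T ρ)

theorem trivialize_polyElt (p : MvPolynomial (Fin n) ℂ) :
    P.trivialize (P.polyElt h p) = polyGauss (Q + P.hessHol) p :=
  P.trivialize_polyGauss p

/-- The default value 0 of `toSpace` is not taken, since the generator is square-integrable. -/
theorem generator_eq : P.generator Q = P.polyElt h 1 := by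
  have h1 : (fun z : Fin n → ℂ => Complex.exp (-(z ⬝ᵥ Q *ᵥ z))) = polyGauss Q 1 := by
    funext z
    simp [polyGauss]
  rw [generator, h1, toSpace]
  exact dif_pos (P.polyGauss_mem h 1)

theorem inner_polyElt_creationPoly (i : Fin n) (p q : MvPolynomial (Fin n) ℂ) :
    inner ℂ (P.polyElt h (creationPoly (2 * (ρ : ℂ) ^ 2) T i p)) (P.polyElt h q)
      = inner ℂ (P.polyElt h p) (P.polyElt h (MvPolynomial.pderiv i q)) := by
  have hH := h.pair.posHerm.1
  rw [P.inner_eq hH, P.inner_eq hH]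
  simp only [trivialize_polyElt]
  exact integral_creationPoly h i p q

theorem eq_zero_of_inner_polyElt (F : P.SegalBargmann)
    (h0 : ∀ p, inner ℂ (P.polyElt h p) F = 0) : F = 0 := by
  obtain ⟨k, hk0, hk1, hk⟩ := h.pair.contraction
  have h1 := eq_zero_of_forall_integral_eq_zero h.pair.posHerm hk1 hk0 hk
    (P.differentiable_trivialize F.2.1) (P.memLp_trivialize h.pair.posHerm.1 F) (fun p => by
      have := h0 p
      rw [P.inner_eq h.pair.posHerm.1, trivialize_polyElt] at this
      exact this)
  refine Subtype.ext (funext fun z => ?_)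
  have := congrFun h1 z
  exact (mul_eq_zero.1 this).resolve_right (Complex.exp_ne_zero _)

theorem topologicalClosure_range_polyElt :
    (LinearMap.range (P.polyElt h)).topologicalClosure = ⊤ := by
  have := P.completeSpace h.pair.posHerm
  rw [Submodule.topologicalClosure_eq_top_iff, Submodule.eq_bot_iff]
  intro F hF
  exact P.eq_zero_of_inner_polyElt h F fun p => hF _ (LinearMap.mem_range_self _ p)

/-- Integration by parts turns the left side into an integral against F alone, which is bounded in
F. Two bounded functionals that agree on the dense set of polynomial elements are equal, so F never
has to be approximated in the graph norm of Λᵢ. -/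
theorem inner_polyElt_annihilation (i : Fin n) (p : MvPolynomial (Fin n) ℂ)
    (F : (P.annihilation Q i).domain) :
    inner ℂ (P.polyElt h p) (P.annihilation Q i F)
      = inner ℂ (P.polyElt h (creationPoly (2 * (ρ : ℂ) ^ 2) T i p)) (F : P.SegalBargmann) := by
  have hH := h.pair.posHerm.1
  have hu := ((subGaussian_adjSymbol P.hessMixed (Q + P.hessHol) i).star).memLp_mul_polyGauss
    h.pair p
  -- The first vector is not holomorphic, so the pairing is formed in L² and pulled back along
  -- `toL2`.
  set ℓ : P.SegalBargmann →L[ℂ] ℂ :=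
    (innerSL ℂ hu.toLp).comp (P.toL2 hH).toContinuousLinearMap
      - innerSL ℂ (P.polyElt h (creationPoly (2 * (ρ : ℂ) ^ 2) T i p)) with hℓ
  have hℓF : ∀ F, ℓ F = (∫ z, adjSymbol P.hessMixed (Q + P.hessHol) z i *
      (starRingEnd ℂ (polyGauss (Q + P.hessHol) p z) * P.trivialize F z
        * gauss P.hessMixed z ^ 2))
      - inner ℂ (P.polyElt h (creationPoly (2 * (ρ : ℂ) ^ 2) T i p)) F := by
    intro F
    rw [hℓ]
    simp only [sub_apply, ContinuousLinearMap.comp_apply, innerSL_apply_apply]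
    congr 1
    refine (P.inner_toLp_toL2 hH hu F).trans ?_
    refine integral_congr_ae (Filter.Eventually.of_forall fun z => ?_)
    simp only [map_mul, Complex.conj_conj, mul_assoc]
  have hker : LinearMap.ker (ℓ : P.SegalBargmann →ₗ[ℂ] ℂ) = ⊤ := by
    rw [eq_top_iff, ← P.topologicalClosure_range_polyElt h]
    refine Submodule.topologicalClosure_minimal _ ?_ ℓ.isClosed_ker
    rintro _ ⟨q, rfl⟩
    rw [LinearMap.mem_ker]
    change ℓ (P.polyElt h q) = 0
    rw [hℓF, inner_polyElt_creationPoly, P.inner_eq hH]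
    simp only [trivialize_polyElt]
    rw [integral_polyGauss_pderiv h.pair, sub_self]
  have h0 : ℓ (F : P.SegalBargmann) = 0 := by
    have : (F : P.SegalBargmann) ∈ LinearMap.ker (ℓ : P.SegalBargmann →ₗ[ℂ] ℂ) := by
      rw [hker]; trivial
    exact this
  rw [hℓF, sub_eq_zero] at h0
  rw [← h0, P.inner_eq hH, trivialize_polyElt]
  have hFd : Differentiable ℂ (F : P.SegalBargmann).1 := (F : P.SegalBargmann).2.1
  have htr : ∀ z, P.trivialize (P.annihilation Q i F) z
      = fderiv ℂ (P.trivialize (F : P.SegalBargmann)) z (Pi.single i 1)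
        + 2 * ((Q + P.hessHol) *ᵥ z) i * P.trivialize (F : P.SegalBargmann) z :=
    P.trivialize_annihilationExpr i hFd
  have hd2 := P.memLp_trivialize hH (P.annihilation Q i F)
  simp only [htr] at hd2 ⊢
  rw [integral_conj_polyGauss_mul h.pair (P.differentiable_trivialize hFd)
    (P.memLp_trivialize hH F) i hd2]
  refine integral_congr_ae (Filter.Eventually.of_forall fun z => ?_)
  simp only [adjSymbol]
  ring

theorem mem_adjoint_graph (i : Fin n) (p : MvPolynomial (Fin n) ℂ) :
    (P.polyElt h p, P.polyElt h (creationPoly (2 * (ρ : ℂ) ^ 2) T i p))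
      ∈ (P.annihilation Q i).graph.adjoint := by
  rw [Submodule.mem_adjoint_iff]
  intro a b hab
  rw [LinearPMap.mem_graph_iff] at hab
  obtain ⟨F, rfl, rfl⟩ := hab
  have := congrArg (starRingEnd ℂ) (P.inner_polyElt_annihilation h i p F)
  rw [inner_conj_symm, inner_conj_symm] at this
  exact sub_eq_zero.2 this

theorem polyElt_mem_graph (i : Fin n) (p : MvPolynomial (Fin n) ℂ) :
    (P.polyElt h p, P.polyElt h (MvPolynomial.pderiv i p)) ∈ (P.annihilation Q i).graph := by
  have hmem : annihilationExpr Q i (polyGauss Q p) ∈ P.holL2 := by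
    rw [P.annihilationExpr_polyGauss h]
    exact P.polyGauss_mem h _
  rw [LinearPMap.mem_graph_iff]
  exact ⟨⟨P.polyElt h p, hmem⟩, rfl, Subtype.ext (P.annihilationExpr_polyGauss h i p)⟩

/-- The domain of Λᵢ contains the polynomial elements, hence is dense; this makes the adjoint
relation the graph of an operator. -/
theorem adjoint_graph_singleValued (h : LadderData P.hessMixed (Q + P.hessHol) T ρ) (i : Fin n) :
    ∀ x ∈ (P.annihilation Q i).graph.adjoint, x.1 = 0 → x.2 = 0 := by
  intro x hx hx0
  refine P.eq_zero_of_inner_polyElt h _ fun p => ?_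
  have := (Submodule.mem_adjoint_iff _ _).1 hx _ _ (P.polyElt_mem_graph h i p)
  rw [hx0, inner_zero_right, zero_sub, neg_eq_zero] at this
  exact this

/-- Polynomial elements lie in the domain of the adjoint, so the default value 0 of `creationApply`
plays no role. -/
theorem creationApply_polyElt (i : Fin n) (p : MvPolynomial (Fin n) ℂ) :
    P.creationApply Q i (P.polyElt h p)
      = P.polyElt h (creationPoly (2 * (ρ : ℂ) ^ 2) T i p) := by
  have hmem := P.mem_adjoint_graph h i p
  have hdom : P.polyElt h p ∈ (P.creation Q i).domain := ⟨_, hmem, rfl⟩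
  rw [creationApply, dif_pos hdom]
  have h1 := Submodule.mem_graph_toLinearPMap (P.adjoint_graph_singleValued h i)
    ⟨P.polyElt h p, hdom⟩
  have h2 := P.adjoint_graph_singleValued h i _ (Submodule.sub_mem _ h1 hmem) (by simp)
  exact sub_eq_zero.1 h2

end BargmannPhase

/-! ### Hermite-type polynomials generated by the creation operators. -/

section HermitePoly

open MvPolynomial

variable {n : ℕ} (κ : ℂ) (T : Matrix (Fin n) (Fin n) ℂ)

/-- The product of powers of creation operators along a list of indices, applied to `1`. -/
def hermitePoly (L : List (Fin n)) (α : Fin n → ℕ) : MvPolynomial (Fin n) ℂ :=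
  L.foldr (fun i p => (creationPoly κ T i)^[α i] p) 1

theorem hermitePoly_cons (i : Fin n) (L : List (Fin n)) (α : Fin n → ℕ) :
    hermitePoly κ T (i :: L) α = (creationPoly κ T i)^[α i] (hermitePoly κ T L α) := rfl

theorem pderiv_iterate_creationPoly_of_ne {i j : Fin n} (hij : i ≠ j)
    (p : MvPolynomial (Fin n) ℂ) (m : ℕ) :
    pderiv i ((creationPoly κ T j)^[m] p) = (creationPoly κ T j)^[m] (pderiv i p) := by
  have hs : Function.Semiconj (pderiv (R := ℂ) i) (creationPoly κ T j) (creationPoly κ T j) := by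
    intro q
    rw [pderiv_creationPoly, if_neg hij, zero_smul, add_zero]
  exact hs.iterate_right m p

theorem pderiv_iterate_creationPoly {i : Fin n} {p : MvPolynomial (Fin n) ℂ}
    (hp : pderiv i p = 0) (m : ℕ) :
    pderiv i ((creationPoly κ T i)^[m + 1] p) = ((m + 1) * κ) • (creationPoly κ T i)^[m] p := by
  induction m with
  | zero => simp [pderiv_creationPoly, hp]
  | succ m ih =>
    rw [Function.iterate_succ_apply', pderiv_creationPoly, ih, map_smul,
      ← Function.iterate_succ_apply' (creationPoly κ T i), if_pos rfl, ← add_smul]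
    congr 1
    push_cast
    ring

theorem pderiv_hermitePoly_of_notMem {i : Fin n} {L : List (Fin n)} (hi : i ∉ L)
    (α : Fin n → ℕ) : pderiv i (hermitePoly κ T L α) = 0 := by
  induction L with
  | nil => simp [hermitePoly]
  | cons j L ih =>
    rw [List.mem_cons, not_or] at hi
    rw [hermitePoly_cons, pderiv_iterate_creationPoly_of_ne κ T hi.1, ih hi.2]
    exact iterate_map_zero _ _

theorem hermitePoly_congr {L : List (Fin n)} {α β : Fin n → ℕ} (h : ∀ i ∈ L, α i = β i) :
    hermitePoly κ T L α = hermitePoly κ T L β := by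
  induction L with
  | nil => rfl
  | cons j L ih =>
    rw [hermitePoly_cons, hermitePoly_cons, h j (by simp), ih fun i hi => h i (by simp [hi])]

variable {T}

/-- Commutativity carries the new factor to the place of i in the list; without repetitions,
updating α changes the exponent at that place only. -/
theorem creationPoly_hermitePoly (hT : Tᵀ = T) {i : Fin n} {L : List (Fin n)} (hL : L.Nodup)
    (hi : i ∈ L) (α : Fin n → ℕ) :
    creationPoly κ T i (hermitePoly κ T L α)
      = hermitePoly κ T L (Function.update α i (α i + 1)) := by
  induction L with
  | nil => simp at hi
  | cons j L ih =>
    rw [List.nodup_cons] at hL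
    rw [hermitePoly_cons, hermitePoly_cons]
    rcases eq_or_ne i j with rfl | hij
    · rw [Function.update_self, Function.iterate_succ_apply']
      congr 2
      refine hermitePoly_congr κ T fun k hk => ?_
      have hki : k ≠ i := by
        rintro rfl
        exact hL.1 hk
      rw [Function.update_of_ne hki]
    · rw [Function.update_of_ne hij.symm, ← ih hL.2 ((List.mem_cons.1 hi).resolve_left hij)]
      have hs : Function.Semiconj (creationPoly κ T i) (creationPoly κ T j)
          (creationPoly κ T j) := creationPoly_comm κ hT i j
      exact hs.iterate_right _ _

/-- The Hermite-type polynomials span all polynomials. -/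
theorem span_hermitePoly (hT : Tᵀ = T) (hκ : κ ≠ 0) :
    Submodule.span ℂ (Set.range (hermitePoly κ T (List.finRange n))) = ⊤ := by
  set W := Submodule.span ℂ (Set.range (hermitePoly κ T (List.finRange n))) with hW
  have hone : (1 : MvPolynomial (Fin n) ℂ) ∈ W := by
    refine Submodule.subset_span ⟨0, ?_⟩
    have : ∀ L : List (Fin n), hermitePoly κ T L 0 = 1 := by
      intro L
      induction L with
      | nil => rfl
      | cons j L ih => rw [hermitePoly_cons, ih]; rfl
    exact this _
  have hc : ∀ i, ∀ p ∈ W, creationPoly κ T i p ∈ W := by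
    intro i p hp
    have hle : W ≤ W.comap (creationPoly κ T i) := by
      rw [hW, Submodule.span_le]
      rintro _ ⟨α, rfl⟩
      refine Submodule.subset_span ⟨_, (creationPoly_hermitePoly κ hT (List.nodup_finRange n)
        (List.mem_finRange i) α).symm⟩
    exact hle hp
  -- V consists of the elements of W whose partial derivatives all stay in W. It contains 1 and is
  -- stable under the creation operators by the commutation relation, so it is all of W.
  have hd : ∀ k, ∀ p ∈ W, pderiv k p ∈ W := by
    let V : Submodule ℂ (MvPolynomial (Fin n) ℂ) :=
      W ⊓ ⨅ k, W.comap (pderiv (R := ℂ) k).toLinearMap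
    have hV : ∀ p, p ∈ V ↔ p ∈ W ∧ ∀ k, pderiv k p ∈ W := by
      intro p
      simp [V, Submodule.mem_inf, Submodule.mem_iInf]
    have hVc : ∀ i, ∀ p ∈ V, creationPoly κ T i p ∈ V := by
      intro i p hp
      rw [hV] at hp ⊢
      refine ⟨hc i p hp.1, fun k => ?_⟩
      rw [pderiv_creationPoly]
      exact W.add_mem (hc i _ (hp.2 k)) (W.smul_mem _ hp.1)
    have hVi : ∀ i m, ∀ p ∈ V, (creationPoly κ T i)^[m] p ∈ V := by
      intro i m p hp
      induction m with
      | zero => exact hp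
      | succ m ih =>
        rw [Function.iterate_succ_apply']
        exact hVc i _ ih
    have hVh : ∀ L α, hermitePoly κ T L α ∈ V := by
      intro L α
      induction L with
      | nil =>
        rw [hV]
        exact ⟨hone, fun k => by simp [hermitePoly]⟩
      | cons j L ih => exact hVi j _ _ ih
    have hle : W ≤ V := by
      rw [hW, Submodule.span_le]
      rintro _ ⟨α, rfl⟩
      exact hVh _ α
    exact fun k p hp => ((hV p).1 (hle hp)).2 k
  -- Solving the definition of cᵢ for zᵢ uses κ ≠ 0.
  have hX : ∀ i, ∀ p ∈ W, p * X i ∈ W := by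
    intro i p hp
    have h1 : p * X i = κ⁻¹ • (creationPoly κ T i p - ∑ k, T i k • pderiv k p) := by
      rw [creationPoly_apply, add_sub_cancel_right, smul_smul, inv_mul_cancel₀ hκ, one_smul,
        mul_comm]
    rw [h1]
    exact W.smul_mem _ (W.sub_mem (hc i p hp)
      (W.sum_mem fun k _ => W.smul_mem _ (hd k p hp)))
  rw [eq_top_iff]
  rintro p -
  induction p using MvPolynomial.induction_on with
  | C a =>
    rw [← mul_one (C a), ← smul_eq_C_mul]
    exact W.smul_mem _ hone
  | add p q hp hq => exact W.add_mem hp hq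
  | mul_X p i hp => exact hX i p hp

end HermitePoly

/-! ### Orthonormality and completeness of the system. -/

namespace BargmannPhase

variable {n : ℕ} (P : BargmannPhase n) {Q T : Matrix (Fin n) (Fin n) ℂ} {ρ : ℝ}
  (h : LadderData P.hessMixed (Q + P.hessHol) T ρ)

theorem hermite_eq (α : Fin n → ℕ) :
    P.hermite Q α
      = P.polyElt h (hermitePoly (2 * (ρ : ℂ) ^ 2) T (List.finRange n) α) := by
  rw [hermite, P.generator_eq h]
  induction List.finRange n with
  | nil => rfl
  | cons i L ih =>
    rw [List.foldr_cons, ih, hermitePoly_cons]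
    have hs : Function.Semiconj (P.polyElt h) (creationPoly (2 * (ρ : ℂ) ^ 2) T i)
        (P.creationApply Q i) := fun p => (P.creationApply_polyElt h i p).symm
    exact (hs.iterate_right _ _).symm

/-- Each step turns one cᵢ on the left into ∂ᵢ on the right, lowering both exponents and producing
the factor bκ. If the exponents differ, some ∂ᵢ eventually meets p or q alone and gives 0. -/
theorem inner_iterate_creationPoly {i : Fin n} {p q : MvPolynomial (Fin n) ℂ}
    (hp : MvPolynomial.pderiv i p = 0) (hq : MvPolynomial.pderiv i q = 0) (a b : ℕ) :
    inner ℂ (P.polyElt h ((creationPoly (2 * (ρ : ℂ) ^ 2) T i)^[a] p))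
        (P.polyElt h ((creationPoly (2 * (ρ : ℂ) ^ 2) T i)^[b] q))
      = if a = b then (2 * (ρ : ℂ) ^ 2) ^ a * (a.factorial : ℂ)
        * inner ℂ (P.polyElt h p) (P.polyElt h q) else 0 := by
  induction a generalizing b with
  | zero =>
    cases b with
    | zero => simp
    | succ b =>
      rw [if_neg (Nat.succ_ne_zero b).symm, Function.iterate_zero, id,
        Function.iterate_succ_apply', ← inner_conj_symm, inner_polyElt_creationPoly, hp, map_zero,
        inner_zero_right, map_zero]
  | succ a ih =>
    rw [Function.iterate_succ_apply', inner_polyElt_creationPoly]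
    cases b with
    | zero =>
      rw [if_neg (Nat.succ_ne_zero a), Function.iterate_zero, id, hq, map_zero, inner_zero_right]
    | succ b =>
      rw [pderiv_iterate_creationPoly _ _ hq, map_smul, inner_smul_right, ih]
      by_cases hab : a = b
      · subst hab
        rw [if_pos rfl, if_pos rfl, Nat.factorial_succ]
        push_cast
        ring
      · rw [if_neg hab, if_neg (by omega), mul_zero]

/-- The indices are peeled off one at a time: the polynomial built from the tail is annihilated by
∂ᵢ because i does not occur there. -/
theorem inner_hermitePoly {L : List (Fin n)} (hL : L.Nodup) (α β : Fin n → ℕ) :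
    inner ℂ (P.polyElt h (hermitePoly (2 * (ρ : ℂ) ^ 2) T L α))
        (P.polyElt h (hermitePoly (2 * (ρ : ℂ) ^ 2) T L β))
      = if ∀ i ∈ L, α i = β i then
          (L.map fun i => (2 * (ρ : ℂ) ^ 2) ^ α i * ((α i).factorial : ℂ)).prod
            * inner ℂ (P.polyElt h 1) (P.polyElt h 1) else 0 := by
  induction L with
  | nil => simp [hermitePoly]
  | cons i L ih =>
    rw [List.nodup_cons] at hL
    rw [hermitePoly_cons, hermitePoly_cons,
      P.inner_iterate_creationPoly h (pderiv_hermitePoly_of_notMem _ _ hL.1 α)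
      (pderiv_hermitePoly_of_notMem _ _ hL.1 β), ih hL.2]
    simp only [List.forall_mem_cons, List.map_cons, List.prod_cons]
    by_cases h1 : α i = β i
    · by_cases h2 : ∀ k ∈ L, α k = β k
      · rw [if_pos h1, if_pos h2, if_pos ⟨h1, h2⟩]
        ring
      · rw [if_pos h1, if_neg h2, if_neg fun h => h2 h.2, mul_zero]
    · rw [if_neg h1, if_neg fun h => h1 h.1]

theorem norm_generator_ne_zero
    (h : LadderData P.hessMixed (Q + P.hessHol) T ρ) : ‖P.generator Q‖ ≠ 0 := by
  rw [norm_ne_zero_iff, P.generator_eq h]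
  intro h0
  have h1 := congrFun (congrArg Subtype.val h0) 0
  change polyGauss Q 1 0 = 0 at h1
  simp [polyGauss] at h1

theorem orthonormal_hermiteNormalized 
    (h : LadderData P.hessMixed (Q + P.hessHol) T ρ) :
    Orthonormal ℂ (P.hermiteNormalized Q ρ) := by
  have hg := P.norm_generator_ne_zero h
  have hρ := h.pos
  rw [orthonormal_iff_ite]
  intro α β
  rw [hermiteNormalized, hermiteNormalized, inner_smul_left, inner_smul_right, P.hermite_eq h,
    P.hermite_eq h, P.inner_hermitePoly h (List.nodup_finRange n)]
  simp only [List.mem_finRange, forall_const, ← funext_iff]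
  split_ifs with hαβ
  · subst hαβ
    have hin : inner ℂ (P.generator Q) (P.generator Q) = ((‖P.generator Q‖ ^ 2 : ℝ) : ℂ) := by
      rw [inner_self_eq_norm_sq_to_K, Complex.ofReal_pow]
      rfl
    rw [← P.generator_eq h, hin, ← List.ofFn_eq_map, List.prod_ofFn,
      Finset.prod_mul_distrib, Finset.prod_pow_eq_pow_sum, Complex.conj_ofReal]
    set s : ℝ := (2 * ρ ^ 2) ^ (∑ i, α i) * ∏ i, ((α i).factorial : ℝ) with hs
    have hs0 : 0 < s := by
      have : 0 < ∏ i, ((α i).factorial : ℝ) :=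
        Finset.prod_pos fun i _ => by exact_mod_cast Nat.factorial_pos _
      positivity
    have hs' : (2 * (ρ : ℂ) ^ 2) ^ (∑ i, α i) * ∏ i, ((α i).factorial : ℂ) = (s : ℂ) := by
      rw [hs]
      push_cast
      rfl
    rw [hs']
    have hreal : 1 / (√s * ‖P.generator Q‖) * (1 / (√s * ‖P.generator Q‖)
        * (s * ‖P.generator Q‖ ^ 2)) = 1 := by
      have h1 : √s ≠ 0 := (Real.sqrt_pos.2 hs0).ne'
      have h2 : s = √s ^ 2 := (Real.sq_sqrt hs0.le).symm
      field_simp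
      exact h2
    exact_mod_cast hreal
  · simp

theorem span_hermiteNormalized_closure 
    (h : LadderData P.hessMixed (Q + P.hessHol) T ρ) :
    (Submodule.span ℂ (Set.range (P.hermiteNormalized Q ρ))).topologicalClosure = ⊤ := by
  have hρ := h.pos
  have hκ : (2 * (ρ : ℂ) ^ 2) ≠ 0 := by
    have : (ρ : ℂ) ≠ 0 := by exact_mod_cast hρ.ne'
    exact mul_ne_zero two_ne_zero (pow_ne_zero 2 this)
  rw [eq_top_iff, ← P.topologicalClosure_range_polyElt h]
  refine Submodule.topologicalClosure_mono ?_
  rw [LinearMap.range_eq_map, ← span_hermitePoly _ h.symm hκ, Submodule.map_span,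
    Submodule.span_le]
  rintro _ ⟨_, ⟨α, rfl⟩, rfl⟩
  rw [← P.hermite_eq h]
  set c : ℂ := ((1 / (√((2 * ρ ^ 2) ^ (∑ i, α i) * ∏ i, ((α i).factorial : ℝ))
    * ‖P.generator Q‖) : ℝ) : ℂ) with hc
  have hc0 : c ≠ 0 := by
    have : 0 < ∏ i, ((α i).factorial : ℝ) :=
      Finset.prod_pos fun i _ => by exact_mod_cast Nat.factorial_pos _
    have h1 : 0 < ‖P.generator Q‖ := (norm_nonneg _).lt_of_ne' (P.norm_generator_ne_zero h)
    rw [hc, Complex.ofReal_ne_zero]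
    positivity
  have hmem : c • P.hermite Q α ∈ Submodule.span ℂ (Set.range (P.hermiteNormalized Q ρ)) :=
    Submodule.subset_span ⟨α, rfl⟩
  exact (Submodule.smul_mem_iff _ hc0).1 hmem

end BargmannPhase

end

theorem theorem10 (n : ℕ) (hn : 0 < n) (P : BargmannPhase n)
    (U : Matrix (Fin n) (Fin n) ℂ) (hU : U ∈ Matrix.unitaryGroup (Fin n) ℂ)
    (lam : Fin n → ℝ) (hlam : ∀ i, 0 < lam i)
    (hdiag : Uᴴ * P.hessMixed * U = Matrix.diagonal fun i => ((lam i : ℂ)) ^ 2)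
    (ρ : ℝ) (hρ : 0 < ρ) (hρlam : ρ < ⨅ i, lam i)
    (X : Matrix (Fin n) (Fin n) ℂ) (hX : X ∈ Matrix.unitaryGroup (Fin n) ℂ)
    (hXsymm : Xᵀ * Matrix.diagonal (fun i => ((BargmannPhase.mu ρ lam i / lam i : ℝ) : ℂ)) =
      Matrix.diagonal (fun i => ((BargmannPhase.mu ρ lam i / lam i : ℝ) : ℂ)) * X) :
    ∃ b : HilbertBasis (Fin n → ℕ) ℂ P.SegalBargmann,
      ∀ α : Fin n → ℕ, b α = P.hermiteNormalized (P.matQ U X ρ lam) ρ α := by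
  have hρlam' : ∀ i, ρ < lam i := fun i =>
    hρlam.trans_le (ciInf_le (Set.finite_range lam).bddBelow i)
  -- Adding Φ''_zz to Q leaves exactly the product U diag(μ) X diag(λ) ᵗU.
  obtain ⟨hpair, S, hS, hS1, hS2⟩ := gaussianPair_of_diagonalization hn hU hlam hdiag hρ hρlam' hX
    hXsymm (R := P.matQ U X ρ lam + P.hessHol) (by rw [BargmannPhase.matQ]; abel)
  have h := LadderData.of_matrix hpair hρ hS hS1 hS2
  have := P.completeSpace hpair.posHerm
  refine ⟨HilbertBasis.mk (P.orthonormal_hermiteNormalized h)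
    (P.span_hermiteNormalized_closure h).ge, fun α => ?_⟩
  rw [HilbertBasis.coe_mk]
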